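/- For a set $X$, a family $\mathcal A$ of non-empty subsets of $X$ is an \emph{upfamily} if $A\in\mathcal A$ and $A\subseteq B\subseteq X$ imply $B\in\mathcal A$; it is \emph{linked} if $A\cap B\neq\emptyset$ for all $A,B\in\mathcal A$. A \emph{maximal linked upfamily} is a linked upfamily that equals every linked upfamily containing it; the set of all of them is denoted $\lambda(X)$. For a semigroup $S$ the set $\lambda(S)$ is a semigroup (the \emph{superextension} of $S$) under $$\mathcal A*\mathcal B=\Big\{C\subseteq S:\ \bigcup_{a\in A}aB_a\subseteq C\ \text{ for some } A\in\mathcal A \text{ and } \{B_a\}_{a\in A}\subseteq\mathcal B\Big\}.$$ For positive integers $r,m$ let $M_{r,m}$ denote any monogenic semigroup of index $r$ and period $m$, that is, a semigroup $\{a,a^2,\dots,a^{r+m-1}\}$ with exactly $r+m-1$ elements and with $a^{r+m}=a^r$. For $k\ge1$ let $M_{r,m}^{\cdot k}=\{x_1\cdots x_k: x_1,\dots,x_k\in M_{r,m}\}$, an ideal of $M_{r,m}$ regarded as a semigroup. Let $C_n$ be the cyclic group of order $n$, $S_n$ the symmetric group on $n$ letters, and $\mathrm{Aut}$ the automorphism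 group of a semigroup. \textbf{Theorem.} For all $r,m\geq 1$ with $|M_{r,m}|=r+m-1\le 5$ the groups $\mathrm{Aut}(\lambda(M_{r,m}))$, and $\mathrm{Aut}(\lambda(M_{r,m}^{\cdot k}))$ for $k\ge 1$, are, up to isomorphism, the following (the case $k=1$ is $M_{r,m}^{\cdot1}=M_{r,m}$). 1. $\mathrm{Aut}(\lambda(M_{1,1}))$, $\mathrm{Aut}(\lambda(M_{1,2}))$, $\mathrm{Aut}(\lambda(M_{2,1}))$ and $\mathrm{Aut}(\lambda(M_{3,1}))$ are trivial, and so are $\mathrm{Aut}(\lambda(M^{\cdot k}))$ for each of these four semigroups $M$ and all $k\ge1$. 2. $\mathrm{Aut}(\lambda(M_{1,3}))\cong C_2$, $\mathrm{Aut}(\lambda(M_{1,4}))\cong C_2\times C_2$, $\mathrm{Aut}(\lambda(M_{1,5}))\cong C_4$, and for $m=3,4,5$ the group $\mathrm{Aut}(\lambda(M_{1,m}^{\cdot k}))$ is isomorphic to the same group as $\mathrm{Aut}(\lambda(M_{1,m}))$ for all $k\ge 1$. 3. $\mathrm{Aut}(\lambda(M_{2,2}))\cong C_2$, and $\mathrm{Aut}(\lambda(M_{2,2}^{\cdot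 k}))\cong C_1$ for $k\ge2$. 4. $\mathrm{Aut}(\lambda(M_{2,3}))\cong S_3\times S_5$, and $\mathrm{Aut}(\lambda(M_{2,3}^{\cdot k}))\cong C_2$ for $k\ge2$. 5. $\mathrm{Aut}(\lambda(M_{3,2}))\cong S_3\times S_4$, $\mathrm{Aut}(\lambda(M_{3,2}^{\cdot 2}))\cong C_2$, and $\mathrm{Aut}(\lambda(M_{3,2}^{\cdot k}))\cong C_1$ for $k\ge3$. 6. $\mathrm{Aut}(\lambda(M_{4,1}))\cong S_3\times S_4$, $\mathrm{Aut}(\lambda(M_{4,1}^{\cdot 2}))\cong S_3$, and $\mathrm{Aut}(\lambda(M_{4,1}^{\cdot k}))\cong C_1$ for $k\ge3$. 7. $\mathrm{Aut}(\lambda(M_{2,4}))\cong S_3^3\times S_8^3\times S_{17}\times S_{19}$, and $\mathrm{Aut}(\lambda(M_{2,4}^{\cdot k}))\cong C_2\times C_2$ for $k\ge2$. 8. $\mathrm{Aut}(\lambda(M_{3,3}))\cong S_4^3\times S_5\times S_9^2\times S_{14}\times S_{18}$, $\mathrm{Aut}(\lambda(M_{3,3}^{\cdot 2}))\cong S_3\times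 S_5$, and $\mathrm{Aut}(\lambda(M_{3,3}^{\cdot k}))\cong C_2$ for $k\ge3$. 9. $\mathrm{Aut}(\lambda(M_{4,2}))\cong S_4^3\times S_5\times S_9^2\times S_{14}\times S_{18}$, $\mathrm{Aut}(\lambda(M_{4,2}^{\cdot 2}))\cong S_5\times S_5$, $\mathrm{Aut}(\lambda(M_{4,2}^{\cdot 3}))\cong C_2$, and $\mathrm{Aut}(\lambda(M_{4,2}^{\cdot k}))\cong C_1$ for $k\ge4$. 10. $\mathrm{Aut}(\lambda(M_{5,1}))\cong S_4^3\times S_5\times S_9^2\times S_{14}\times S_{18}$, $\mathrm{Aut}(\lambda(M_{5,1}^{\cdot 2}))\cong S_9$, $\mathrm{Aut}(\lambda(M_{5,1}^{\cdot 3}))\cong S_3$, and $\mathrm{Aut}(\lambda(M_{5,1}^{\cdot k}))\cong C_1$ for $k\ge4$. -/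

import Mathlib

universe u

/-- An upfamily on `X`: a family of non-empty subsets closed under taking supersets. -/
def IsUpfamily {X : Type u} (L : Set (Set X)) : Prop :=
  (∀ A ∈ L, A.Nonempty) ∧ ∀ A ∈ L, ∀ B : Set X, A ⊆ B → B ∈ L

/-- A linked family: any two members intersect. -/
def IsLinkedFamily {X : Type u} (L : Set (Set X)) : Prop :=
  ∀ A ∈ L, ∀ B ∈ L, (A ∩ B).Nonempty

/-- A maximal linked upfamily: a linked upfamily which coincides with each linked upfamily
containing it. -/
def IsMaximalLinked {X : Type u} (M : Set (Set X)) : Prop :=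
  IsUpfamily M ∧ IsLinkedFamily M ∧
    ∀ L : Set (Set X), IsUpfamily L → IsLinkedFamily L → M ⊆ L → M = L

/-- The superextension of `X`: the set of all maximal linked upfamilies on `X`. -/
def Superextension (X : Type u) : Type u :=
  {M : Set (Set X) // IsMaximalLinked M}

/-- The product of upfamilies, i.e. the upfamily generated by the sets `⋃ a ∈ A, a * B a` with
`A ∈ P` and `B a ∈ Q` for every `a ∈ A`. -/
def upfamilyMul {S : Type u} [Mul S] (P Q : Set (Set S)) : Set (Set S) :=
  {C | ∃ A ∈ P, ∃ B : S → Set S, (∀ a ∈ A, B a ∈ Q) ∧ (⋃ a ∈ A, (fun b => a * b) '' B a) ⊆ C}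

theorem mem_upfamilyMul {S : Type u} [Mul S] {P Q : Set (Set S)} (hP : IsUpfamily P)
    (hQ : IsUpfamily Q) (C : Set S) :
    C ∈ upfamilyMul P Q ↔ {a | {b | a * b ∈ C} ∈ Q} ∈ P := by
  constructor
  · rintro ⟨A, hA, B, hB, hC⟩
    refine hP.2 A hA _ fun a ha => hQ.2 (B a) (hB a ha) _ fun b hb => hC ?_
    exact Set.mem_biUnion ha ⟨b, hb, rfl⟩
  · intro h
    refine ⟨_, h, fun a => {b | a * b ∈ C}, fun a ha => ha, ?_⟩
    intro x hx
    simp only [Set.mem_iUnion] at hx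
    obtain ⟨a, _, b, hb, rfl⟩ := hx
    exact hb

theorem IsMaximalLinked.mem_of_meets {X : Type u} {M : Set (Set X)} (hM : IsMaximalLinked M)
    {A : Set X} (hA : A.Nonempty) (h : ∀ B ∈ M, (A ∩ B).Nonempty) : A ∈ M := by
  obtain ⟨hu, hl, hmax⟩ := hM
  have key := hmax (M ∪ {C | A ⊆ C}) ?_ ?_ Set.subset_union_left
  · rw [key]
    exact Or.inr (Set.Subset.refl A)
  · refine ⟨?_, ?_⟩
    · rintro C (hC | hC)
      · exact hu.1 C hC
      · exact hA.mono hC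
    · rintro C (hC | hC) D hD
      · exact Or.inl (hu.2 C hC D hD)
      · exact Or.inr (Set.Subset.trans hC hD)
  · rintro C (hC | hC) D (hD | hD)
    · exact hl C hC D hD
    · rw [Set.inter_comm]
      exact (h C hC).mono (Set.inter_subset_inter_left _ hD)
    · exact (h D hD).mono (Set.inter_subset_inter_left _ hC)
    · obtain ⟨x, hx⟩ := hA
      exact ⟨x, hC hx, hD hx⟩

theorem IsMaximalLinked.compl_mem {X : Type u} [Nonempty X] {M : Set (Set X)}
    (hM : IsMaximalLinked M) {A : Set X} (hA : A ∉ M) : Aᶜ ∈ M := by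
  have huniv : Set.univ ∈ M := hM.mem_of_meets Set.univ_nonempty fun B hB => by
    simpa using hM.1.1 B hB
  have h : ∀ B ∈ M, (Aᶜ ∩ B).Nonempty := by
    intro B hB
    by_contra hne
    refine hA (hM.1.2 B hB A fun x hx => ?_)
    by_contra hxA
    exact hne ⟨x, hxA, hx⟩
  exact hM.mem_of_meets ((h _ huniv).mono Set.inter_subset_left) h

theorem IsMaximalLinked.mul {S : Type u} [Mul S] {P Q : Set (Set S)} (hP : IsMaximalLinked P)
    (hQ : IsMaximalLinked Q) : IsMaximalLinked (upfamilyMul P Q) := by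
  have hm := mem_upfamilyMul hP.1 hQ.1
  refine ⟨⟨?_, ?_⟩, ?_, ?_⟩
  · intro C hC
    obtain ⟨a, ha⟩ := hP.1.1 _ ((hm C).1 hC)
    obtain ⟨b, hb⟩ := hQ.1.1 _ ha
    exact ⟨a * b, hb⟩
  · rintro C ⟨A, hA, B, hB, hC⟩ D hD
    exact ⟨A, hA, B, hB, hC.trans hD⟩
  · intro C hC D hD
    obtain ⟨a, haC, haD⟩ := hP.2.1 _ ((hm C).1 hC) _ ((hm D).1 hD)
    obtain ⟨b, hbC, hbD⟩ := hQ.2.1 _ haC _ haD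
    exact ⟨a * b, hbC, hbD⟩
  · intro L hLu hLl hsub
    refine Set.Subset.antisymm hsub fun C hC => ?_
    obtain ⟨c, _⟩ := hLu.1 C hC
    have : Nonempty S := ⟨c⟩
    rw [hm]
    by_contra hD
    have hcompl : Cᶜ ∈ upfamilyMul P Q := by
      rw [hm]
      exact hP.1.2 _ (hP.compl_mem hD) _ fun a ha => hQ.compl_mem ha
    obtain ⟨x, hx, hx'⟩ := hLl C hC _ (hsub hcompl)
    exact hx' hx

/-- The superextension of a semigroup is a semigroup under the product of upfamilies. -/
instance Superextension.instSemigroup {S : Type u} [Semigroup S] :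
    Semigroup (Superextension S) where
  mul P Q := ⟨upfamilyMul P.1 Q.1, P.2.mul Q.2⟩
  mul_assoc P Q R := by
    refine Subtype.ext (Set.ext fun C => ?_)
    change C ∈ upfamilyMul (upfamilyMul P.1 Q.1) R.1 ↔ C ∈ upfamilyMul P.1 (upfamilyMul Q.1 R.1)
    rw [mem_upfamilyMul (P.2.mul Q.2).1 R.2.1, mem_upfamilyMul P.2.1 Q.2.1,
      mem_upfamilyMul P.2.1 (Q.2.mul R.2).1]
    simp only [mem_upfamilyMul Q.2.1 R.2.1, Set.mem_ofPred_eq, mul_assoc]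

/-- `S` is a finite monogenic semigroup of index `r` and period `m`: for some generator `a`,
`S = {a ^ n : n ≥ 1}`, `|S| = r + m - 1` and `a ^ (r + m) = a ^ r`. (Powers are computed in the
monoid obtained from `S` by adjoining a unit, as only positive exponents occur.) -/
structure IsMonogenicOfIndexPeriod (S : Type u) [Semigroup S] (r m : ℕ) : Prop where
  index_pos : 0 < r
  period_pos : 0 < m
  card_eq : Nat.card S = r + m - 1
  exists_generator : ∃ a : S,
    (∀ x : S, ∃ n : ℕ, 0 < n ∧ (x : WithOne S) = (a : WithOne S) ^ n) ∧
      (a : WithOne S) ^ (r + m) = (a : WithOne S) ^ r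

/-- The set of all products of `n + 1` elements of `S`. -/
def prodSet (S : Type u) [Semigroup S] : ℕ → Set S
  | 0 => Set.univ
  | n + 1 => {z | ∃ x ∈ prodSet S n, ∃ y : S, z = x * y}

theorem prodSet_succ_subset (S : Type u) [Semigroup S] (n : ℕ) :
    prodSet S (n + 1) ⊆ prodSet S n := by
  induction n with
  | zero => exact fun _ _ => Set.mem_univ _
  | succ n ih =>
    rintro z ⟨x, hx, y, rfl⟩
    exact ⟨x, ih hx, y, rfl⟩

/-- For `k ≥ 1`, the ideal of all products `x₁ ⋯ x_k` of `k` elements of `S`, as a semigroup of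
its own. -/
def idealPow (S : Type u) [Semigroup S] (k : ℕ) : Subsemigroup S where
  carrier := prodSet S (k - 1)
  mul_mem' {a b} ha _ := prodSet_succ_subset S (k - 1) ⟨a, ha, b, rfl⟩

/-- The automorphism group of the superextension of `S`. -/
abbrev AutSuperext (S : Type u) [Semigroup S] : Type u := MulAut (Superextension S)

/-- The cyclic group of order `n`. -/
abbrev CyclicGrp (n : ℕ) : Type := Multiplicative (ZMod n)

/-- The symmetric group on `n` letters. -/
abbrev SymGrp (n : ℕ) : Type := Equiv.Perm (Fin n)

/-!
The theorem is a finite computation, organised so that the kernel can carry it out.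

A subset of `{0, …, N - 1}` is coded by the number whose binary digits form its indicator function,
and a family of subsets by the number whose binary digits mark the codes of its members. A maximal
linked family is the same as a monotone family containing exactly one of any two complementary sets
(`mem_maxLinkedCodes`), and a set belongs to a product of two families if and only if the set of all
`a` for which `{b | a * b ∈ C}` is in the second family belongs to the first. Hence a semigroup
operation on `{0, …, N - 1}` turns the superextension into an explicit multiplication of numbers
(`exists_isCoding`). The semigroup of all products of `k` factors consists of the powers `a ^ k,
a ^ (k + 1), …` of the generator `a`; for `k` below the index `r` its operation is `powerOp r m k`,
and for `k ≥ r` it is the cyclic group of order `m` (`exists_equiv_powerOp`,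
`exists_equiv_cyclicOp`).

If `k < r`, a product of two families depends only on the values of the factors at few sets. Label a
family which is a product by itself, and any other family by its values at these sets. Products are
then determined by labels, and every product is the only family with its label, so that permutations
of families preserving labels are automorphisms. Conversely, automorphisms preserve the labels:
they preserve being idempotent and sums over factorizations and over products, and three rounds of
such refinements tell all labels apart. The automorphism group is therefore the product of the
symmetric groups on the sets of families with the same label (`IsBlowup.nonempty_mulEquiv`); it
remains to count the families with each label. For the cyclic groups of order `1` and `2` the same
method applies, each label being carried by one family.

For the cyclic groups of order `3`, `4` and `5` there are few automorphisms, and they are found by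
hand. An automorphism preserves the unit of the superextension, hence maps the principal ultrafilter
at a generator to an element of the same order. For order `4` one more family has to be followed,
which has two possible images. An automorphism fixing these families is trivial: the other families
are products of these, or the zero (for order `3`), or they are recovered from their products with
three idempotents fixed by the automorphism (for order `5`). This
bounds the order of the automorphism group
by `2`, `4` and `4`. Automorphisms of the cyclic group, and in order `4` a map moving a single orbit
of translations, show that the bounds are attained, and identify the groups.
-/

/-! ### Blow-ups of multiplication tables and colour refinement -/

/-- The weighted sum `∑ s * g k` over the entries `(k, s)` of the list `K`. The recursors used here
and below are evaluated by the kernel faster than compiled pattern matching. -/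
noncomputable def wsum (K : List (ℕ × ℕ)) (g : ℕ → ℕ) : ℕ :=
  List.rec 0 (fun p _ ih => Nat.add (Nat.mul p.2 (g p.1)) ih) K

theorem wsum_eq (K : List (ℕ × ℕ)) (g : ℕ → ℕ) : wsum K g = (K.map fun p => p.2 * g p.1).sum := by
  induction K with
  | nil => rfl
  | cons p K ih => rw [List.map_cons, List.sum_cons, ← ih]; rfl

/-- Evaluates `x` before passing it on. This is the identity on values; the recursor makes the
kernel reduce `x` to a numeral first, so that it is not recomputed at every use. -/
def force {α : Type} (x : ℕ) (f : ℕ → α) : α :=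
  Nat.rec (f 0) (fun k _ => f (Nat.succ k)) x

theorem force_eq {α : Type} (x : ℕ) (f : ℕ → α) : force x f = f x := by
  cases x <;> rfl

/-- The table of values of `f` at the labels in `K`. -/
noncomputable def tabulate (K : List (ℕ × ℕ)) (f : ℕ → ℕ) : List (ℕ × ℕ) :=
  List.rec [] (fun p _ ih => force (f p.1) fun v => (p.1, v) :: ih) K

/-- The value stored in the table `t` at `k`, and `0` if there is none. -/
noncomputable def lookupD (t : List (ℕ × ℕ)) (k : ℕ) : ℕ :=
  List.rec 0 (fun p _ ih => cond (Nat.beq p.1 k) p.2 ih) t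

theorem lookupD_tabulate {K : List (ℕ × ℕ)} (f : ℕ → ℕ) {p : ℕ × ℕ} (hp : p ∈ K) :
    lookupD (tabulate K f) p.1 = f p.1 := by
  induction K with
  | nil => simp at hp
  | cons q K ih =>
    have h1 : lookupD (tabulate (q :: K) f) p.1 =
        cond (Nat.beq q.1 p.1) (f q.1) (lookupD (tabulate K f) p.1) := by
      have h0 : tabulate (q :: K) f = force (f q.1) fun v => (q.1, v) :: tabulate K f := rfl
      rw [h0, force_eq]
      rfl
    rw [h1]
    by_cases h : q.1 = p.1
    · simp [h]
    · have h2 : Nat.beq q.1 p.1 = false := by simpa [← Nat.beq_eq] using h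
      rw [h2]
      rcases List.mem_cons.1 hp with rfl | hp
      · exact absurd rfl h
      · exact ih hp

/-- `cls` exhibits the magma `T` as a blow-up of the multiplication `M` on labels: products depend
only on the labels of the factors, and are the only elements with their label. The list `K` consists
of the pairs `(k, s)`, where `k` is a label and `s` the number of elements with this label. -/
structure IsBlowup (T : Type u) [Mul T] (cls : T → ℕ) (M : ℕ → ℕ → ℕ) (K : List (ℕ × ℕ)) :
    Prop where
  cls_mul : ∀ x y, cls (x * y) = M (cls x) (cls y)
  eq_mul : ∀ x y z, cls z = cls (x * y) → z = x * y
  nodup : (K.map Prod.fst).Nodup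
  mem : ∀ x, ∃ p ∈ K, p.1 = cls x
  card : ∀ p ∈ K, Nat.card {x // cls x = p.1} = p.2

/-- A function of labels is invariant if automorphisms do not change its value. -/
def IsInvariantColor {T : Type u} [Mul T] (cls : T → ℕ) (f : ℕ → ℕ) : Prop :=
  ∀ (φ : MulAut T) (x : T), f (cls (φ x)) = f (cls x)

/-- The colouring which tells idempotents from other elements. -/
noncomputable def idempotentColor (M : ℕ → ℕ → ℕ) (k : ℕ) : ℕ :=
  cond (Nat.beq (M k k) k) 2 1

/-- Refinement of a colouring `f` of the labels by factorizations: to the colour of `z` a sum over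
all factorizations `z = x * y` of an expression in the colours of `x` and `y` is added. -/
noncomputable def factorColor (M : ℕ → ℕ → ℕ) (K : List (ℕ × ℕ)) (f : ℕ → ℕ) (k : ℕ) : ℕ :=
  Nat.add (f k) (wsum K fun a => wsum K fun b =>
    cond (Nat.beq (M a b) k) (Nat.mul (f a) (Nat.add (f a) (f b))) 0)

/-- Refinement of a colouring `f` of the labels by products: to the colour of `x` a sum over all `y`
of an expression in the colours of `y`, `x * y` and `y * x` is added. -/
noncomputable def productColor (M : ℕ → ℕ → ℕ) (K : List (ℕ × ℕ)) (f : ℕ → ℕ) (k : ℕ) : ℕ :=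
  Nat.add (f k) (wsum K fun l => force (f (M k l)) fun v =>
    Nat.mul (Nat.mul (f l) v) (Nat.add v (Nat.mul 2 (f (M l k)))))

/-- The colouring of the labels obtained from `idempotentColor` in three rounds of refinement. -/
noncomputable def labelColor (M : ℕ → ℕ → ℕ) (K : List (ℕ × ℕ)) : ℕ → ℕ :=
  let f := lookupD (tabulate K (factorColor M K (idempotentColor M)))
  let g := lookupD (tabulate K (productColor M K f))
  lookupD (tabulate K (factorColor M K g))

namespace IsBlowup

variable {T : Type u} [Mul T] {cls : T → ℕ} {M : ℕ → ℕ → ℕ} {K : List (ℕ × ℕ)}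

theorem sum_cls [Fintype T] (h : IsBlowup T cls M K) (g : ℕ → ℕ) :
    ∑ x, g (cls x) = wsum K g := by
  classical
  have hm : ∀ x ∈ (Finset.univ : Finset T), cls x ∈ (K.map Prod.fst).toFinset := by
    intro x _
    obtain ⟨p, hp, hx⟩ := h.mem x
    simpa using ⟨p.2, by rw [← hx]; exact hp⟩
  rw [← Finset.sum_fiberwise_of_maps_to hm, List.sum_toFinset _ h.nodup, List.map_map, wsum_eq]
  refine congrArg List.sum (List.map_congr_left fun p hp => ?_)
  have h1 : ∑ x ∈ Finset.univ.filter (fun x => cls x = p.1), g (cls x) =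
      ∑ x ∈ Finset.univ.filter (fun x => cls x = p.1), g p.1 :=
    Finset.sum_congr rfl fun x hx => by rw [(Finset.mem_filter.1 hx).2]
  change ∑ x ∈ Finset.univ.filter (fun x => cls x = p.1), g (cls x) = _
  rw [h1, Finset.sum_const, smul_eq_mul, ← h.card p hp, Nat.card_eq_fintype_card,
    Fintype.card_subtype]

theorem cls_mul_eq_iff (h : IsBlowup T cls M K) (x y z : T) :
    M (cls x) (cls y) = cls z ↔ x * y = z := by
  rw [← h.cls_mul]
  exact ⟨fun H => (h.eq_mul x y z H.symm).symm, fun H => by rw [H]⟩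

theorem isInvariant_idempotentColor (h : IsBlowup T cls M K) :
    IsInvariantColor cls (idempotentColor M) := by
  intro φ x
  have h1 : M (cls (φ x)) (cls (φ x)) = cls (φ x) ↔ M (cls x) (cls x) = cls x := by
    rw [h.cls_mul_eq_iff, h.cls_mul_eq_iff, ← map_mul, φ.injective.eq_iff]
  have h2 : Nat.beq (M (cls (φ x)) (cls (φ x))) (cls (φ x)) =
      Nat.beq (M (cls x) (cls x)) (cls x) := by
    rw [Bool.eq_iff_iff, Nat.beq_eq, Nat.beq_eq, h1]
  unfold idempotentColor
  rw [h2]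

theorem isInvariant_factorColor [Finite T] (h : IsBlowup T cls M K) {f : ℕ → ℕ}
    (hf : IsInvariantColor cls f) : IsInvariantColor cls (factorColor M K f) := by
  classical
  have : Fintype T := Fintype.ofFinite T
  have key : ∀ z, factorColor M K f (cls z) = f (cls z) +
      ∑ x, ∑ y, if x * y = z then f (cls x) * (f (cls x) + f (cls y)) else 0 := by
    intro z
    unfold factorColor
    rw [← h.sum_cls]
    refine congrArg (f (cls z) + ·) (Finset.sum_congr rfl fun x _ => ?_)
    rw [← h.sum_cls]
    refine Finset.sum_congr rfl fun y _ => ?_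
    by_cases H : x * y = z
    · rw [(h.cls_mul_eq_iff x y z).2 H, if_pos H, Nat.beq_refl, cond_true]
      rfl
    · have h2 : Nat.beq (M (cls x) (cls y)) (cls z) = false := by
        simpa [← Nat.beq_eq] using mt (h.cls_mul_eq_iff x y z).1 H
      rw [if_neg H, h2, cond_false]
  intro φ z
  rw [key, key, hf]
  congr 1
  rw [← Equiv.sum_comp φ.toEquiv]
  refine Finset.sum_congr rfl fun x _ => ?_
  rw [← Equiv.sum_comp φ.toEquiv]
  refine Finset.sum_congr rfl fun y _ => ?_
  change (if φ x * φ y = φ z then f (cls (φ x)) * (f (cls (φ x)) + f (cls (φ y))) else 0) = _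
  rw [← map_mul, φ.injective.eq_iff, hf, hf]

theorem isInvariant_productColor [Finite T] (h : IsBlowup T cls M K) {f : ℕ → ℕ}
    (hf : IsInvariantColor cls f) : IsInvariantColor cls (productColor M K f) := by
  have : Fintype T := Fintype.ofFinite T
  have key : ∀ x, productColor M K f (cls x) = f (cls x) +
      ∑ y, f (cls y) * f (cls (x * y)) * (f (cls (x * y)) + 2 * f (cls (y * x))) := by
    intro x
    unfold productColor
    rw [← h.sum_cls]
    simp only [h.cls_mul, force_eq]
    rfl
  intro φ x
  rw [key, key, ← Equiv.sum_comp φ.toEquiv]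
  have e : ∀ y, φ.toEquiv y = φ y := fun _ => rfl
  simp only [e, ← map_mul, hf φ]

theorem isInvariant_tabulate (h : IsBlowup T cls M K) {f : ℕ → ℕ} (hf : IsInvariantColor cls f) :
    IsInvariantColor cls (lookupD (tabulate K f)) := by
  intro φ x
  obtain ⟨p, hp, hx⟩ := h.mem x
  obtain ⟨q, hq, hy⟩ := h.mem (φ x)
  rw [← hx, ← hy, lookupD_tabulate f hp, lookupD_tabulate f hq, hx, hy, hf]

/-- If the refined colours tell all labels apart, automorphisms preserve labels. -/
theorem cls_apply [Finite T] (h : IsBlowup T cls M K)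
    (hc : ∀ p ∈ K, ∀ q ∈ K, labelColor M K p.1 = labelColor M K q.1 → p.1 = q.1)
    (φ : MulAut T) (x : T) : cls (φ x) = cls x := by
  obtain ⟨p, hp, hx⟩ := h.mem x
  obtain ⟨q, hq, hy⟩ := h.mem (φ x)
  have hi : IsInvariantColor cls (labelColor M K) :=
    h.isInvariant_tabulate (h.isInvariant_factorColor (h.isInvariant_tabulate
      (h.isInvariant_productColor (h.isInvariant_tabulate
        (h.isInvariant_factorColor h.isInvariant_idempotentColor)))))
  rw [← hx, ← hy]
  refine hc q hq p hp ?_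
  rw [hx, hy, hi]

/-- If automorphisms preserve labels, every family of permutations of the sets of elements with a
given label is an automorphism, and the labels carried by a single element do not contribute. -/
theorem nonempty_mulEquiv [Finite T] (h : IsBlowup T cls M K)
    (hc : ∀ p ∈ K, ∀ q ∈ K, labelColor M K p.1 = labelColor M K q.1 → p.1 = q.1)
    {I : Type} (lab sz : I → ℕ) (hlab : Function.Injective lab) (hsz : ∀ i, (lab i, sz i) ∈ K)
    (hone : ∀ p ∈ K, p.2 = 1 ∨ ∃ i, lab i = p.1) :
    Nonempty (MulAut T ≃* ∀ i, Equiv.Perm (Fin (sz i))) := by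
  classical
  have hcls := h.cls_apply hc
  let Φ : MulAut T →* ∀ i, Equiv.Perm {x // cls x = lab i} :=
    { toFun := fun φ i => Equiv.Perm.subtypePerm φ.toEquiv fun x => by
        change cls (φ x) = _ ↔ _
        rw [hcls]
      map_one' := rfl
      map_mul' := fun _ _ => rfl }
  have hsub : ∀ x y, cls x = cls y → (∀ i, lab i ≠ cls x) → x = y := by
    intro x y hxy hi
    obtain ⟨p, hp, hpx⟩ := h.mem x
    rcases hone p hp with h1 | ⟨i, h1⟩
    · have h2 := h.card p hp
      rw [h1, Nat.card_eq_one_iff_unique] at h2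
      have := h2.1
      exact congrArg Subtype.val
        (Subsingleton.elim (⟨x, hpx.symm⟩ : {x // cls x = p.1}) ⟨y, by rw [hpx, hxy]⟩)
    · exact absurd (h1.trans hpx) (hi i)
  have hinj : Function.Injective Φ := by
    intro φ ψ hφψ
    refine MulEquiv.ext fun x => ?_
    by_cases hx : ∃ i, lab i = cls x
    · obtain ⟨i, hi⟩ := hx
      have := congrFun hφψ i
      exact congrArg Subtype.val (Equiv.Perm.ext_iff.1 this ⟨x, hi.symm⟩)
    · push Not at hx
      exact hsub _ _ (by rw [hcls, hcls]) fun i => by rw [hcls]; exact hx i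
  have hsurj : Function.Surjective Φ := by
    intro σ
    let τ : ∀ k : ℕ, Equiv.Perm {x // cls x = k} := fun k =>
      if H : ∃ i, lab i = k then H.choose_spec ▸ σ H.choose else 1
    have hτ : ∀ i, τ (lab i) = σ i := by
      intro i
      have H : ∃ j, lab j = lab i := ⟨i, rfl⟩
      have h1 : τ (lab i) = H.choose_spec ▸ σ H.choose := dif_pos H
      have h2 : ∀ j (hj : lab j = lab i), (hj ▸ σ j : Equiv.Perm {x // cls x = lab i}) = σ i := by
        intro j hj
        obtain rfl := hlab hj
        rfl
      rw [h1, h2]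
    let g : Equiv.Perm T := (Equiv.sigmaFiberEquiv cls).permCongr (Equiv.Perm.sigmaCongrRight τ)
    have hg : ∀ x, g x = (τ (cls x) ⟨x, rfl⟩ : {y // cls y = cls x}) := fun x => rfl
    have hgc : ∀ x, cls (g x) = cls x := fun x => (τ (cls x) ⟨x, rfl⟩).2
    refine ⟨MulEquiv.mk g fun x y => ?_, ?_⟩
    · change g (x * y) = g x * g y
      have h1 : g x * g y = x * y := h.eq_mul x y _ (by rw [h.cls_mul, h.cls_mul, hgc, hgc])
      rw [h1]
      exact h.eq_mul x y _ (hgc _)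
    · funext i
      refine Equiv.ext fun x => Subtype.ext ?_
      obtain ⟨x, hx⟩ := x
      change g x = _
      rw [hg, ← hτ]
      have h2 : ∀ k (hk : cls x = k), ((τ (cls x) ⟨x, rfl⟩ : {y // cls y = cls x}) : T) =
          (τ k ⟨x, hk⟩ : {y // cls y = k}) := by
        rintro _ rfl
        rfl
      exact h2 _ hx
  refine ⟨(MulEquiv.ofBijective Φ ⟨hinj, hsurj⟩).trans (MulEquiv.piCongrRight fun i => ?_)⟩
  exact (Finite.equivFinOfCardEq (h.card _ (hsz i))).permCongrHom

end IsBlowup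

/-! ### Codes of maximal linked families -/

/-- The binary digit of `F` at position `C`. -/
def bit (F C : ℕ) : ℕ := Nat.land 1 (Nat.shiftRight F C)

/-- The number with binary digits `f 0, …, f (n - 1)`. -/
noncomputable def bits (n : ℕ) (f : ℕ → ℕ) : ℕ :=
  Nat.rec 0 (fun k acc => Nat.add acc (Nat.mul (f k) (Nat.pow 2 k))) n

theorem bit_eq (F C : ℕ) : bit F C = (F.testBit C).toNat := by
  have h : bit F C = 1 &&& (F >>> C) := rfl
  have h2 : F.testBit C = (1 &&& (F >>> C) != 0) := rfl
  rw [h, h2, Nat.one_and_eq_mod_two]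
  rcases Nat.mod_two_eq_zero_or_one (F >>> C) with h | h <;> simp [h]

theorem bits_succ (n : ℕ) (f : ℕ → ℕ) : bits (n + 1) f = 2 ^ n * f n + bits n f := by
  change bits n f + f n * 2 ^ n = _
  ring

theorem bits_lt (n : ℕ) (f : ℕ → Bool) : bits n (fun k => (f k).toNat) < 2 ^ n := by
  induction n with
  | zero => exact Nat.one_pos
  | succ n ih =>
    rw [bits_succ, pow_succ]
    have := Bool.toNat_le (f n)
    nlinarith

theorem testBit_bits (n : ℕ) (f : ℕ → Bool) (i : ℕ) :
    (bits n fun k => (f k).toNat).testBit i = (decide (i < n) && f i) := by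
  induction n with
  | zero => simp [bits]
  | succ n ih =>
    rw [bits_succ, Nat.testBit_two_pow_mul_add _ (bits_lt n f)]
    split_ifs with h
    · rw [ih]
      simp [h, h.trans (Nat.lt_succ_self n)]
    · rcases Nat.eq_or_lt_of_le (not_lt.1 h) with rfl | h
      · cases f n <;> simp
      · have h1 : ¬ i < n + 1 := by omega
        obtain ⟨d, hd⟩ : ∃ d, i - n = d + 1 := ⟨i - n - 1, by omega⟩
        cases f n <;> simp [h1, hd, Nat.testBit_succ]

theorem lt_two_pow_of_testBit {F N : ℕ} (h : ∀ i, N ≤ i → F.testBit i = false) : F < 2 ^ N :=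
  Nat.lt_pow_two_of_testBit F h

theorem testBit_sub_of_lt {n C : ℕ} (hC : C < 2 ^ n) (i : ℕ) :
    (2 ^ n - 1 - C).testBit i = (decide (i < n) && !C.testBit i) := by
  rw [Nat.sub_sub, Nat.add_comm 1 C]
  exact Nat.testBit_two_pow_sub_succ hC i

/-- The values `g a` at the entries `a` of `l` with `p a`, in front of the list `r`. -/
noncomputable def collect (p : ℕ → Bool) (g : ℕ → ℕ) (l r : List ℕ) : List ℕ :=
  List.rec r (fun a _ ih => cond (p a) (force (g a) fun v => v :: ih) ih) l

theorem mem_collect {p : ℕ → Bool} {g : ℕ → ℕ} {l r : List ℕ} {x : ℕ} :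
    x ∈ collect p g l r ↔ (∃ a ∈ l, p a = true ∧ g a = x) ∨ x ∈ r := by
  induction l with
  | nil => simp [collect]
  | cons a l ih =>
    have h : collect p g (a :: l) r =
        cond (p a) (force (g a) fun v => v :: collect p g l r) (collect p g l r) := rfl
    rw [h, force_eq]
    cases hp : p a
    · simp [ih, hp]
    · rw [List.exists_mem_cons_iff, or_assoc, ← ih, hp, cond_true, List.mem_cons, eq_comm]
      simp

/-- The codes of the monotone families of subsets of `{0, …, n - 1}`. A set is coded by the number
whose binary digits form its indicator function, and a family by the number whose binary digits
mark the codes of its members. -/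
noncomputable def monotoneCodes (n : ℕ) : List ℕ :=
  Nat.rec [0, 1] (fun n l => List.rec [] (fun a _ ih =>
    collect (fun b => Nat.beq (Nat.land a b) a) (fun b => a + b * 2 ^ 2 ^ n) l ih) l) n

/-- The code of the family of all sets whose complement is not in the family with code `g`. -/
noncomputable def dualCode (n g : ℕ) : ℕ :=
  bits (2 ^ n) fun C => Nat.sub 1 (bit g (Nat.sub (2 ^ n - 1) C))

/-- The codes of the maximal linked families on `{0, …, n}`: such a family is determined by its
members not containing `n`, which form an arbitrary linked monotone family. -/
noncomputable def maxLinkedCodes (n : ℕ) : List ℕ :=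
  collect (fun g => Nat.beq (Nat.land g (dualCode n g)) g) (fun g => g + dualCode n g * 2 ^ 2 ^ n)
    (monotoneCodes n) []

/-- Inclusion of the sets with codes `C` and `D`. -/
def CodeLE (C D : ℕ) : Prop := ∀ i, C.testBit i = true → D.testBit i = true

/-- `F` is the code of a monotone family of subsets of `{0, …, n - 1}`. -/
def IsMonotoneCode (n F : ℕ) : Prop :=
  F < 2 ^ 2 ^ n ∧ ∀ C D, D < 2 ^ n → CodeLE C D → F.testBit C = true → F.testBit D = true

/-- Of any two complementary sets, exactly one belongs to the family with code `F`. -/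
def IsSelfDualCode (n F : ℕ) : Prop :=
  ∀ C, C < 2 ^ n → F.testBit (2 ^ n - 1 - C) = !F.testBit C

theorem land_eq_left_iff {a b : ℕ} : Nat.beq (Nat.land a b) a = true ↔ CodeLE a b := by
  rw [Nat.beq_eq]
  change a &&& b = a ↔ _
  constructor
  · intro h i hi
    rw [← h, Nat.testBit_and] at hi
    simp_all
  · intro h
    refine Nat.eq_of_testBit_eq fun i => ?_
    rw [Nat.testBit_and]
    cases hi : a.testBit i
    · rfl
    · rw [h i hi]; rfl

theorem CodeLE.le_of_lt {C D : ℕ} (h : CodeLE C D) : C ≤ D := by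
  have : C = C &&& D := by
    have := (land_eq_left_iff.2 h)
    rw [Nat.beq_eq] at this
    exact this.symm
  rw [this]
  exact Nat.and_le_right

theorem testBit_add_mul {a N : ℕ} (b : ℕ) (ha : a < 2 ^ N) (j : ℕ) :
    (a + b * 2 ^ N).testBit j = if j < N then a.testBit j else b.testBit (j - N) := by
  rw [add_comm, mul_comm]
  exact Nat.testBit_two_pow_mul_add b ha j

theorem testBit_two_pow_add_of_lt {C n : ℕ} (hC : C < 2 ^ n) (j : ℕ) :
    (2 ^ n + C).testBit j = if j < n then C.testBit j else decide (j = n) := by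
  have := Nat.testBit_two_pow_mul_add 1 hC j
  rw [mul_one] at this
  rw [this]
  split_ifs with h
  · rfl
  · rcases Nat.eq_or_lt_of_le (not_lt.1 h) with rfl | h
    · simp
    · obtain ⟨d, hd⟩ : ∃ d, j - n = d + 1 := ⟨j - n - 1, by omega⟩
      have h2 : ¬ j = n := by omega
      simp [hd, Nat.testBit_succ, h2]

theorem mem_monotoneCodes_succ {n F : ℕ} : F ∈ monotoneCodes (n + 1) ↔
    ∃ a ∈ monotoneCodes n, ∃ b ∈ monotoneCodes n, CodeLE a b ∧ a + b * 2 ^ 2 ^ n = F := by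
  have key : ∀ l l' : List ℕ, F ∈ (List.rec [] (fun a _ ih =>
      collect (fun b => Nat.beq (Nat.land a b) a) (fun b => a + b * 2 ^ 2 ^ n) l' ih) l : List ℕ) ↔
      ∃ a ∈ l, ∃ b ∈ l', CodeLE a b ∧ a + b * 2 ^ 2 ^ n = F := by
    intro l l'
    induction l with
    | nil => simp
    | cons a l ih =>
      rw [List.exists_mem_cons_iff, ← ih]
      simp only [← land_eq_left_iff]
      exact mem_collect
  exact key _ _

theorem mem_monotoneCodes {n F : ℕ} : F ∈ monotoneCodes n ↔ IsMonotoneCode n F := by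
  induction n generalizing F with
  | zero =>
    have h : F ∈ monotoneCodes 0 ↔ F < 2 := by
      change F ∈ [0, 1] ↔ _
      simp
      omega
    rw [h]
    refine ⟨fun h => ⟨by simpa using h, fun C D hD hCD hC => ?_⟩, fun h => by simpa using h.1⟩
    have h1 : C ≤ D := hCD.le_of_lt
    have h2 : D = 0 := by simpa using hD
    have h3 : C = 0 := by omega
    rw [h2, ← h3]; exact hC
  | succ n ih =>
    have hpow : 2 ^ 2 ^ (n + 1) = 2 ^ 2 ^ n * 2 ^ 2 ^ n := by rw [← pow_add]; congr 1; ring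
    have hp2 : 2 ^ (n + 1) = 2 ^ n + 2 ^ n := by ring
    rw [mem_monotoneCodes_succ]
    simp only [ih]
    constructor
    · rintro ⟨a, ⟨ha, ha'⟩, b, ⟨hb, hb'⟩, hab, rfl⟩
      refine ⟨by rw [hpow]; nlinarith, fun C D hD hCD hC => ?_⟩
      rw [testBit_add_mul b ha] at hC ⊢
      have hle := hCD.le_of_lt
      by_cases h1 : D < 2 ^ n
      · rw [if_pos h1]
        rw [if_pos (lt_of_le_of_lt hle h1)] at hC
        exact ha' C D h1 hCD hC
      · rw [if_neg h1]
        obtain ⟨D', rfl⟩ : ∃ D', D = 2 ^ n + D' := ⟨D - 2 ^ n, by omega⟩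
        have hD' : D' < 2 ^ n := by omega
        rw [Nat.add_sub_cancel_left]
        split_ifs at hC with h2
        · refine hab _ (ha' C D' hD' (fun i hi => ?_) hC)
          have h3 := hCD i hi
          rw [testBit_two_pow_add_of_lt hD'] at h3
          split_ifs at h3 with h4
          · exact h3
          · exact absurd hi (by
              rw [Nat.testBit_lt_two_pow (lt_of_lt_of_le h2 (Nat.pow_le_pow_right two_pos
                (not_lt.1 h4)))]
              simp)
        · obtain ⟨C', rfl⟩ : ∃ C', C = 2 ^ n + C' := ⟨C - 2 ^ n, by omega⟩
          have hC' : C' < 2 ^ n := by omega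
          rw [Nat.add_sub_cancel_left] at hC
          refine hb' C' D' hD' (fun i hi => ?_) hC
          have h3 : i < n := by
            by_contra h3
            rw [Nat.testBit_lt_two_pow (lt_of_lt_of_le hC' (Nat.pow_le_pow_right two_pos
                (not_lt.1 h3)))] at hi
            simp at hi
          have h4 := hCD i (by rw [testBit_two_pow_add_of_lt hC', if_pos h3]; exact hi)
          rwa [testBit_two_pow_add_of_lt hD', if_pos h3] at h4
    · rintro ⟨hF, hF'⟩
      have ha : F % 2 ^ 2 ^ n < 2 ^ 2 ^ n := Nat.mod_lt _ (by positivity)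
      have hb : F / 2 ^ 2 ^ n < 2 ^ 2 ^ n := Nat.div_lt_of_lt_mul (by rw [← hpow]; exact hF)
      have hab : F % 2 ^ 2 ^ n + F / 2 ^ 2 ^ n * 2 ^ 2 ^ n = F := Nat.mod_add_div' _ _
      have hA : ∀ C, C < 2 ^ n → (F % 2 ^ 2 ^ n).testBit C = F.testBit C := by
        intro C hC
        simp [Nat.testBit_mod_two_pow, hC]
      have hA' : ∀ C, ¬ C < 2 ^ n → (F % 2 ^ 2 ^ n).testBit C = false := by
        intro C hC
        simp [Nat.testBit_mod_two_pow, hC]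
      have hB : ∀ C, (F / 2 ^ 2 ^ n).testBit C = F.testBit (2 ^ n + C) := by
        intro C
        rw [Nat.testBit_div_two_pow, add_comm]
      refine ⟨_, ⟨ha, fun C D hD hCD hC => ?_⟩, _, ⟨hb, fun C D hD hCD hC => ?_⟩, fun C hC => ?_,
        hab⟩
      · rw [hA D hD]
        rw [hA C (lt_of_le_of_lt hCD.le_of_lt hD)] at hC
        exact hF' C D (by omega) hCD hC
      · rw [hB] at hC ⊢
        have hC1 := lt_of_le_of_lt hCD.le_of_lt hD
        refine hF' _ _ (by omega) (fun i hi => ?_) hC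
        rw [testBit_two_pow_add_of_lt hC1] at hi
        rw [testBit_two_pow_add_of_lt hD]
        split_ifs at hi ⊢
        · exact hCD i hi
        · exact hi
      · have h1 : C < 2 ^ n := by
          by_contra h
          rw [hA' C h] at hC
          simp at hC
        rw [hA C h1] at hC
        rw [hB]
        refine hF' C _ (by omega) (fun i hi => ?_) hC
        rw [testBit_two_pow_add_of_lt h1]
        split_ifs with h2
        · exact hi
        · rw [Nat.testBit_lt_two_pow (lt_of_lt_of_le h1 (Nat.pow_le_pow_right two_pos
            (not_lt.1 h2)))] at hi
          simp at hi

theorem dualCode_eq (n g : ℕ) :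
    dualCode n g = bits (2 ^ n) fun C => (!g.testBit (2 ^ n - 1 - C)).toNat := by
  unfold dualCode
  congr 1
  funext C
  rw [bit_eq]
  change 1 - (g.testBit (2 ^ n - 1 - C)).toNat = _
  cases g.testBit (2 ^ n - 1 - C) <;> rfl

theorem testBit_dualCode (n g C : ℕ) :
    (dualCode n g).testBit C = (decide (C < 2 ^ n) && !g.testBit (2 ^ n - 1 - C)) := by
  rw [dualCode_eq]
  exact testBit_bits (2 ^ n) (fun C => !g.testBit (2 ^ n - 1 - C)) C

theorem isMonotoneCode_dualCode {n g : ℕ} (hg : IsMonotoneCode n g) :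
    IsMonotoneCode n (dualCode n g) := by
  refine ⟨by rw [dualCode_eq]; exact bits_lt _ fun C => !g.testBit (2 ^ n - 1 - C),
    fun C D hD hCD hC => ?_⟩
  have hC1 := lt_of_le_of_lt hCD.le_of_lt hD
  rw [testBit_dualCode] at hC ⊢
  simp only [hC1, hD, decide_true, Bool.true_and, Bool.not_eq_true'] at hC ⊢
  by_contra h
  rw [Bool.not_eq_false] at h
  rw [hg.2 _ (2 ^ n - 1 - C) (by omega) (fun i hi => ?_) h] at hC
  · simp at hC
  · rw [testBit_sub_of_lt hD] at hi
    rw [testBit_sub_of_lt hC1]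
    simp only [Bool.and_eq_true, decide_eq_true_eq, Bool.not_eq_true'] at hi ⊢
    refine ⟨hi.1, ?_⟩
    by_contra h2
    rw [hCD i (by simpa using h2)] at hi
    simp at hi

theorem mem_maxLinkedCodes {n F : ℕ} :
    F ∈ maxLinkedCodes n ↔ IsMonotoneCode (n + 1) F ∧ IsSelfDualCode (n + 1) F := by
  have hp2 : 2 ^ (n + 1) = 2 ^ n + 2 ^ n := by ring
  have h0 : F ∈ maxLinkedCodes n ↔
      ∃ g ∈ monotoneCodes n, CodeLE g (dualCode n g) ∧ g + dualCode n g * 2 ^ 2 ^ n = F := by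
    simp only [← land_eq_left_iff]
    refine mem_collect.trans ?_
    simp
  rw [h0, ← mem_monotoneCodes, mem_monotoneCodes_succ]
  simp only [mem_monotoneCodes]
  constructor
  · rintro ⟨g, hg, hle, rfl⟩
    refine ⟨⟨g, hg, _, isMonotoneCode_dualCode hg, hle, rfl⟩, fun C hC => ?_⟩
    rw [testBit_add_mul _ hg.1, testBit_add_mul _ hg.1]
    by_cases h : C < 2 ^ n
    · have h1 : ¬ 2 ^ (n + 1) - 1 - C < 2 ^ n := by omega
      have h2 : 2 ^ (n + 1) - 1 - C - 2 ^ n < 2 ^ n := by omega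
      have h3 : 2 ^ n - 1 - (2 ^ (n + 1) - 1 - C - 2 ^ n) = C := by omega
      rw [if_neg h1, if_pos h, testBit_dualCode, h3]
      simp [h2]
    · have h1 : 2 ^ (n + 1) - 1 - C < 2 ^ n := by omega
      have h2 : C - 2 ^ n < 2 ^ n := by omega
      have h3 : 2 ^ n - 1 - (C - 2 ^ n) = 2 ^ (n + 1) - 1 - C := by omega
      rw [if_pos h1, if_neg h, testBit_dualCode, h3]
      simp [h2]
  · rintro ⟨⟨a, ha, b, hb, hab, rfl⟩, hd⟩
    have hbd : b = dualCode n a := by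
      refine Nat.eq_of_testBit_eq fun C => ?_
      rw [testBit_dualCode]
      by_cases h : C < 2 ^ n
      · have h1 := hd (2 ^ n - 1 - C) (by omega)
        have h2 : 2 ^ (n + 1) - 1 - (2 ^ n - 1 - C) = 2 ^ n + C := by omega
        rw [h2, testBit_add_mul _ ha.1, testBit_add_mul _ ha.1, if_neg (by omega),
          if_pos (by omega), Nat.add_sub_cancel_left] at h1
        simp [h, h1]
      · rw [Nat.testBit_lt_two_pow (lt_of_lt_of_le hb.1 (Nat.pow_le_pow_right two_pos
          (not_lt.1 h)))]
        simp [h]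
    rw [hbd] at hab ⊢
    exact ⟨a, ha, hab, rfl⟩

/-! ### Superextensions of finite semigroups in terms of codes -/

/-- The code of the set `{b | op a b ∈ C}`, where `C` also denotes the set with code `C`. -/
noncomputable def preCode (N : ℕ) (op : ℕ → ℕ → ℕ) (a C : ℕ) : ℕ :=
  bits N fun b => bit C (op a b)

/-- The code of the set of all `a` for which `{b | op a b ∈ C}` belongs to the family `G`. -/
noncomputable def innerCode (N : ℕ) (op : ℕ → ℕ → ℕ) (G C : ℕ) : ℕ :=
  bits N fun a => bit G (preCode N op a C)

/-- The product of upfamilies in terms of codes. -/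
noncomputable def mulCode (N : ℕ) (op : ℕ → ℕ → ℕ) (F G : ℕ) : ℕ :=
  bits (2 ^ N) fun C => bit F (innerCode N op G C)

theorem testBit_preCode (N : ℕ) (op : ℕ → ℕ → ℕ) (a C b : ℕ) :
    (preCode N op a C).testBit b = (decide (b < N) && C.testBit (op a b)) := by
  unfold preCode
  simp only [bit_eq]
  exact testBit_bits N (fun b => C.testBit (op a b)) b

theorem testBit_innerCode (N : ℕ) (op : ℕ → ℕ → ℕ) (G C a : ℕ) :
    (innerCode N op G C).testBit a = (decide (a < N) && G.testBit (preCode N op a C)) := by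
  unfold innerCode
  simp only [bit_eq]
  exact testBit_bits N (fun a => G.testBit (preCode N op a C)) a

theorem testBit_mulCode (N : ℕ) (op : ℕ → ℕ → ℕ) (F G C : ℕ) :
    (mulCode N op F G).testBit C =
      (decide (C < 2 ^ N) && F.testBit (innerCode N op G C)) := by
  unfold mulCode
  simp only [bit_eq]
  exact testBit_bits (2 ^ N) (fun C => F.testBit (innerCode N op G C)) C

theorem preCode_lt (N : ℕ) (op : ℕ → ℕ → ℕ) (a C : ℕ) : preCode N op a C < 2 ^ N :=
  lt_two_pow_of_testBit fun i hi => by rw [testBit_preCode]; simp [hi]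

theorem innerCode_lt (N : ℕ) (op : ℕ → ℕ → ℕ) (G C : ℕ) : innerCode N op G C < 2 ^ N :=
  lt_two_pow_of_testBit fun i hi => by rw [testBit_innerCode]; simp [hi]

/-- `code` identifies the magma `T` with the numbers in the list `L`, multiplied by `mul`. -/
structure IsCoding (T : Type u) [Mul T] (L : List ℕ) (mul : ℕ → ℕ → ℕ) (code : T → ℕ) :
    Prop where
  injective : Function.Injective code
  mem : ∀ x, code x ∈ L
  surj : ∀ F ∈ L, ∃ x, code x = F
  code_mul : ∀ x y, code (x * y) = mul (code x) (code y)

theorem IsCoding.finite {T : Type u} [Mul T] {L : List ℕ} {mul : ℕ → ℕ → ℕ} {code : T → ℕ}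
    (h : IsCoding T L mul code) : Finite T :=
  Finite.of_injective (fun x => (⟨code x, h.mem x⟩ : {F // F ∈ L})) fun _ _ hxy =>
    h.injective (congrArg Subtype.val hxy)

section Coding

variable {S : Type u} {N : ℕ} (e : S ≃ Fin N)

/-- The set with code `C`, transported along the enumeration `e`. -/
def decodeSet (C : ℕ) : Set S := {x | C.testBit (e x) = true}

open Classical in
/-- The code of the set `A` with respect to the enumeration `e`. -/
noncomputable def encodeSet (A : Set S) : ℕ :=
  bits N fun i => (decide (∃ x ∈ A, (e x : ℕ) = i)).toNat

open Classical in
/-- The code of the family `M` with respect to the enumeration `e`. -/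
noncomputable def encodeFamily (M : Set (Set S)) : ℕ :=
  bits (2 ^ N) fun C => (decide (decodeSet e C ∈ M)).toNat

theorem encodeSet_lt (A : Set S) : encodeSet e A < 2 ^ N := bits_lt N _

theorem testBit_encodeSet (A : Set S) (x : S) : (encodeSet e A).testBit (e x) = true ↔ x ∈ A := by
  classical
  unfold encodeSet
  rw [testBit_bits N fun i => decide (∃ x ∈ A, (e x : ℕ) = i)]
  simp only [(e x).2, decide_true, Bool.true_and, decide_eq_true_eq]
  constructor
  · rintro ⟨y, hy, hxy⟩
    rwa [← e.injective (Fin.ext hxy)]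
  · exact fun h => ⟨x, h, rfl⟩

theorem decodeSet_encodeSet (A : Set S) : decodeSet e (encodeSet e A) = A :=
  Set.ext fun x => testBit_encodeSet e A x

theorem codeLE_of_decodeSet_subset {C D : ℕ} (hC : C < 2 ^ N)
    (h : decodeSet e C ⊆ decodeSet e D) : CodeLE C D := by
  intro i hi
  have hiN : i < N := by
    by_contra hn
    rw [Nat.testBit_lt_two_pow (lt_of_lt_of_le hC (Nat.pow_le_pow_right two_pos (not_lt.1 hn)))]
      at hi
    simp at hi
  have := @h (e.symm ⟨i, hiN⟩)
  simp only [decodeSet, Set.mem_ofPred_eq, Equiv.apply_symm_apply] at this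
  exact this hi

theorem encodeSet_decodeSet {C : ℕ} (hC : C < 2 ^ N) : encodeSet e (decodeSet e C) = C := by
  have h := decodeSet_encodeSet e (decodeSet e C)
  exact le_antisymm (codeLE_of_decodeSet_subset e (encodeSet_lt e _) h.le).le_of_lt
    (codeLE_of_decodeSet_subset e hC h.ge).le_of_lt

theorem decodeSet_mono {C D : ℕ} (h : CodeLE C D) : decodeSet e C ⊆ decodeSet e D :=
  fun _ hx => h _ hx

theorem decodeSet_compl {C : ℕ} (hC : C < 2 ^ N) :
    decodeSet e (2 ^ N - 1 - C) = (decodeSet e C)ᶜ := by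
  ext x
  simp only [decodeSet, Set.mem_compl_iff, Set.mem_ofPred_eq]
  rw [testBit_sub_of_lt hC]
  simp

theorem encodeSet_compl (A : Set S) : encodeSet e Aᶜ = 2 ^ N - 1 - encodeSet e A := by
  have h : Aᶜ = decodeSet e (2 ^ N - 1 - encodeSet e A) := by
    rw [decodeSet_compl e (encodeSet_lt e A), decodeSet_encodeSet]
  have := encodeSet_lt e A
  rw [h, encodeSet_decodeSet e (by omega)]

theorem testBit_encodeFamily (M : Set (Set S)) {C : ℕ} (hC : C < 2 ^ N) :
    (encodeFamily e M).testBit C = true ↔ decodeSet e C ∈ M := by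
  classical
  unfold encodeFamily
  rw [testBit_bits (2 ^ N) fun C => decide (decodeSet e C ∈ M)]
  simp [hC]

theorem encodeFamily_lt (M : Set (Set S)) : encodeFamily e M < 2 ^ 2 ^ N := bits_lt (2 ^ N) _

theorem encodeFamily_injective : Function.Injective (encodeFamily e) := by
  intro M M' h
  ext A
  have h1 := testBit_encodeFamily e M (encodeSet_lt e A)
  have h2 := testBit_encodeFamily e M' (encodeSet_lt e A)
  rw [decodeSet_encodeSet] at h1 h2
  rw [← h1, ← h2, h]

end Coding

theorem encodeFamily_mem {S : Type u} {n : ℕ} (e : S ≃ Fin (n + 1)) {M : Set (Set S)}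
    (hM : IsMaximalLinked M) : encodeFamily e M ∈ maxLinkedCodes n := by
  have : Nonempty S := ⟨e.symm 0⟩
  rw [mem_maxLinkedCodes]
  refine ⟨⟨encodeFamily_lt e M, fun C D hD hCD hC => ?_⟩, fun C hC => ?_⟩
  · rw [testBit_encodeFamily e M (lt_of_le_of_lt hCD.le_of_lt hD)] at hC
    rw [testBit_encodeFamily e M hD]
    exact hM.1.2 _ hC _ (decodeSet_mono e hCD)
  · rw [Bool.eq_iff_iff, testBit_encodeFamily e M (by omega), decodeSet_compl e hC,
      Bool.not_eq_true', ← Bool.not_eq_true, testBit_encodeFamily e M hC]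
    constructor
    · intro h1 h2
      obtain ⟨x, hx, hx'⟩ := hM.2.1 _ h1 _ h2
      exact hx hx'
    · exact hM.compl_mem

theorem exists_encodeFamily_eq {S : Type u} {n : ℕ} (e : S ≃ Fin (n + 1)) {F : ℕ}
    (hF : F ∈ maxLinkedCodes n) : ∃ M, IsMaximalLinked M ∧ encodeFamily e M = F := by
  obtain ⟨⟨hlt, hmono⟩, hdual⟩ := mem_maxLinkedCodes.1 hF
  let M : Set (Set S) := {A | F.testBit (encodeSet e A) = true}
  have hmonoM : ∀ A ∈ M, ∀ B : Set S, A ⊆ B → B ∈ M := by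
    intro A hA B hAB
    refine hmono _ _ (encodeSet_lt e B) (codeLE_of_decodeSet_subset e (encodeSet_lt e A) ?_) hA
    rwa [decodeSet_encodeSet, decodeSet_encodeSet]
  have hcompl : ∀ A : Set S, Aᶜ ∈ M ↔ A ∉ M := by
    intro A
    change F.testBit (encodeSet e Aᶜ) = true ↔ ¬ F.testBit (encodeSet e A) = true
    rw [encodeSet_compl, hdual _ (encodeSet_lt e A)]
    simp
  have hne : ∀ A ∈ M, A.Nonempty := by
    intro A hA
    rw [Set.nonempty_iff_ne_empty]
    rintro rfl
    have h1 := hmonoM _ hA _ (Set.empty_subset (∅ : Set S)ᶜ)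
    exact (hcompl _).1 h1 hA
  refine ⟨M, ⟨⟨hne, hmonoM⟩, fun A hA B hB => ?_, fun L _ hLl hsub => ?_⟩, ?_⟩
  · by_contra h
    refine (hcompl B).1 (hmonoM A hA _ fun x hx hxB => h ⟨x, hx, hxB⟩) hB
  · refine Set.Subset.antisymm hsub fun A hA => ?_
    by_contra h
    obtain ⟨x, hx, hx'⟩ := hLl A hA _ (hsub ((hcompl A).2 h))
    exact hx' hx
  · refine Nat.eq_of_testBit_eq fun C => ?_
    by_cases hC : C < 2 ^ (n + 1)
    · rw [Bool.eq_iff_iff, testBit_encodeFamily e M hC]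
      change F.testBit (encodeSet e (decodeSet e C)) = true ↔ _
      rw [encodeSet_decodeSet e hC]
    · have h1 := Nat.pow_le_pow_right two_pos (not_lt.1 hC)
      rw [Nat.testBit_lt_two_pow (lt_of_lt_of_le hlt h1),
        Nat.testBit_lt_two_pow (lt_of_lt_of_le (encodeFamily_lt e M) h1)]

theorem encodeFamily_mul {S : Type u} [Semigroup S] {N : ℕ} (e : S ≃ Fin N) {op : ℕ → ℕ → ℕ}
    (hop : ∀ x y, (e (x * y) : ℕ) = op (e x) (e y)) {P Q : Set (Set S)} (hP : IsUpfamily P)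
    (hQ : IsUpfamily Q) : encodeFamily e (upfamilyMul P Q) =
      mulCode N op (encodeFamily e P) (encodeFamily e Q) := by
  have hpre : ∀ (a : S) (C : ℕ),
      {b | a * b ∈ decodeSet e C} = decodeSet e (preCode N op (e a) C) := by
    intro a C
    ext b
    simp only [decodeSet, Set.mem_ofPred_eq]
    rw [testBit_preCode, hop]
    simp
  refine Nat.eq_of_testBit_eq fun C => ?_
  rw [testBit_mulCode]
  by_cases hC : C < 2 ^ N
  · rw [Bool.eq_iff_iff, testBit_encodeFamily e _ hC, mem_upfamilyMul hP hQ]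
    simp only [hC, decide_true, Bool.true_and]
    rw [testBit_encodeFamily e P (innerCode_lt _ _ _ _)]
    have h : {a | {b | a * b ∈ decodeSet e C} ∈ Q} =
        decodeSet e (innerCode N op (encodeFamily e Q) C) := by
      ext a
      rw [Set.mem_ofPred_eq, hpre, ← testBit_encodeFamily e Q (preCode_lt _ _ _ _)]
      simp only [decodeSet, Set.mem_ofPred_eq]
      rw [testBit_innerCode]
      simp
    rw [h]
  · rw [Nat.testBit_lt_two_pow (lt_of_lt_of_le (encodeFamily_lt e _)
      (Nat.pow_le_pow_right two_pos (not_lt.1 hC)))]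
    simp [hC]

/-- A semigroup operation `op` on `{0, …, n}` determines the superextension up to isomorphism, in
terms of codes. -/
theorem exists_isCoding {S : Type u} [Semigroup S] {n : ℕ} (e : S ≃ Fin (n + 1))
    {op : ℕ → ℕ → ℕ} (hop : ∀ x y, (e (x * y) : ℕ) = op (e x) (e y)) :
    ∃ code, IsCoding (Superextension S) (maxLinkedCodes n) (mulCode (n + 1) op) code := by
  refine ⟨fun M => encodeFamily e M.1, fun M M' h => Subtype.ext (encodeFamily_injective e h),
    fun M => encodeFamily_mem e M.2, fun F hF => ?_,
    fun P Q => encodeFamily_mul e hop P.2.1 Q.2.1⟩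
  obtain ⟨M, hM, h⟩ := exists_encodeFamily_eq e hF
  exact ⟨⟨M, hM⟩, h⟩

/-! ### Labels of families and the checks on them -/

/-- Whether `p` holds for all entries of `l`. -/
noncomputable def allIn {α : Type} (l : List α) (p : α → Bool) : Bool :=
  List.rec true (fun a _ ih => cond (p a) ih false) l

/-- Whether `p` holds for all numbers below `n`. -/
noncomputable def allBelow (n : ℕ) (p : ℕ → Bool) : Bool :=
  Nat.rec true (fun k ih => cond (p k) ih false) n

/-- The number of entries of `l` satisfying `p`. -/
noncomputable def countIn (l : List ℕ) (p : ℕ → Bool) : ℕ :=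
  List.rec 0 (fun a _ ih => cond (p a) (Nat.succ ih) ih) l

/-- Whether `k` is the label of an entry of `K`. -/
noncomputable def hasLabel (K : List (ℕ × ℕ)) (k : ℕ) : Bool :=
  List.rec false (fun p _ ih => cond (Nat.beq p.1 k) true ih) K

theorem allIn_eq_true {α : Type} {l : List α} {p : α → Bool} :
    allIn l p = true ↔ ∀ a ∈ l, p a = true := by
  induction l with
  | nil => simp [allIn]
  | cons a l ih =>
    have h : allIn (a :: l) p = cond (p a) (allIn l p) false := rfl
    rw [h, List.forall_mem_cons, ← ih]
    cases p a <;> simp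

theorem allBelow_eq_true {n : ℕ} {p : ℕ → Bool} :
    allBelow n p = true ↔ ∀ k < n, p k = true := by
  induction n with
  | zero => simp [allBelow]
  | succ n ih =>
    have h : allBelow (n + 1) p = cond (p n) (allBelow n p) false := rfl
    rw [h, Nat.forall_lt_succ_right, ← ih]
    cases p n <;> simp

theorem countIn_eq (l : List ℕ) (p : ℕ → Bool) : countIn l p = (l.filter p).length := by
  induction l with
  | nil => rfl
  | cons a l ih =>
    have h : countIn (a :: l) p = cond (p a) (Nat.succ (countIn l p)) (countIn l p) := rfl
    rw [h, ih]
    cases hp : p a <;> simp [hp]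

theorem hasLabel_eq_true {K : List (ℕ × ℕ)} {k : ℕ} :
    hasLabel K k = true ↔ ∃ p ∈ K, p.1 = k := by
  induction K with
  | nil => simp [hasLabel]
  | cons q K ih =>
    have h : hasLabel (q :: K) k = cond (Nat.beq q.1 k) true (hasLabel K k) := rfl
    rw [h, List.exists_mem_cons_iff, ← ih, ← Nat.beq_eq]
    cases Nat.beq q.1 k <;> simp

/-- The label of the maximal linked family with code `F`: this is `2 * F + 1` if `K` contains this
label (as happens for all products), and otherwise `2 * F'`, where `F'` is the part of `F` on which
products with `F` depend, selected by the mask `m`. -/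
noncomputable def familyLabel (m : ℕ) (K : List (ℕ × ℕ)) (F : ℕ) : ℕ :=
  cond (hasLabel K (Nat.succ (Nat.mul 2 F))) (Nat.succ (Nat.mul 2 F)) (Nat.mul 2 (Nat.land F m))

/-- The label of the product of two families with given labels. -/
noncomputable def labelMul (N : ℕ) (op : ℕ → ℕ → ℕ) (k l : ℕ) : ℕ :=
  force (Nat.div k 2) fun a => force (Nat.div l 2) fun b => Nat.succ (Nat.mul 2 (mulCode N op a b))

/-- Whether multiplication only reads the digits of codes that are selected by `m`. -/
noncomputable def checkMask (L : List ℕ) (N : ℕ) (op : ℕ → ℕ → ℕ) (m : ℕ) : Bool :=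
  cond (allBelow N fun a => allBelow (2 ^ N) fun C => Nat.beq (bit m (preCode N op a C)) 1)
    (allIn L fun G => allBelow (2 ^ N) fun C => Nat.beq (bit m (innerCode N op G C)) 1) false

/-- Whether `K` lists the labels, with the number of families for each. -/
noncomputable def checkLabels (L : List ℕ) (N : ℕ) (op : ℕ → ℕ → ℕ) (m : ℕ)
    (K : List (ℕ × ℕ)) : Bool :=
  cond (allIn L fun F => hasLabel K (familyLabel m K F))
    (cond (allIn K fun p => allIn K fun q => hasLabel K (labelMul N op p.1 q.1))
      (allIn K fun p => Nat.beq (countIn L fun F => Nat.beq (familyLabel m K F) p.1) p.2) false)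
    false

/-- Whether the refined colours of distinct labels are distinct. -/
noncomputable def checkColors (N : ℕ) (op : ℕ → ℕ → ℕ) (K : List (ℕ × ℕ)) : Bool :=
  allIn K fun p => allIn K fun q => cond
    (Nat.beq (labelColor (labelMul N op) K p.1) (labelColor (labelMul N op) K q.1))
    (Nat.beq p.1 q.1) true

theorem labelMul_eq (N : ℕ) (op : ℕ → ℕ → ℕ) (k l : ℕ) :
    labelMul N op k l = 2 * mulCode N op (k / 2) (l / 2) + 1 := by
  unfold labelMul
  rw [force_eq, force_eq]
  rfl

theorem familyLabel_eq (m : ℕ) (K : List (ℕ × ℕ)) (F : ℕ) :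
    familyLabel m K F = if hasLabel K (2 * F + 1) = true then 2 * F + 1 else 2 * (F &&& m) := by
  change cond (hasLabel K (2 * F + 1)) (2 * F + 1) (2 * (F &&& m)) = _
  cases hasLabel K (2 * F + 1) <;> simp

theorem familyLabel_div_two_land (m : ℕ) (K : List (ℕ × ℕ)) (F : ℕ) :
    familyLabel m K F / 2 &&& m = F &&& m := by
  rw [familyLabel_eq]
  split_ifs
  · congr 1
    omega
  · rw [Nat.mul_div_cancel_left _ two_pos, Nat.land_assoc, Nat.and_self]

theorem testBit_eq_of_land_eq {F F' m i : ℕ} (h : F &&& m = F' &&& m) (hi : m.testBit i = true) :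
    F.testBit i = F'.testBit i := by
  have := congrArg (fun t => t.testBit i) h
  simpa [Nat.testBit_and, hi] using this

theorem beq_bit_eq_true {m i : ℕ} (h : Nat.beq (bit m i) 1 = true) : m.testBit i = true := by
  rw [Nat.beq_eq, bit_eq] at h
  simpa using h

theorem mulCode_congr {L : List ℕ} {N : ℕ} {op : ℕ → ℕ → ℕ} {m : ℕ}
    (h : checkMask L N op m = true) {F F' G G' : ℕ} (hG : G ∈ L) (hF : F' &&& m = F &&& m)
    (hG' : G' &&& m = G &&& m) : mulCode N op F' G' = mulCode N op F G := by
  simp only [checkMask, Bool.cond_false_right, Bool.and_eq_true, allIn_eq_true,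
    allBelow_eq_true] at h
  obtain ⟨h1, h2⟩ := h
  refine Nat.eq_of_testBit_eq fun C => ?_
  rw [testBit_mulCode, testBit_mulCode]
  by_cases hC : C < 2 ^ N
  · have h3 : innerCode N op G' C = innerCode N op G C := by
      refine Nat.eq_of_testBit_eq fun a => ?_
      rw [testBit_innerCode, testBit_innerCode]
      by_cases ha : a < N
      · rw [testBit_eq_of_land_eq hG' (beq_bit_eq_true (h1 a ha C hC))]
      · simp [ha]
    rw [h3, testBit_eq_of_land_eq hF (beq_bit_eq_true (h2 G hG C hC))]
  · simp [hC]

theorem IsCoding.isBlowup {T : Type u} [Mul T] {L : List ℕ} {N : ℕ} {op : ℕ → ℕ → ℕ}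
    {code : T → ℕ} (h : IsCoding T L (mulCode N op) code) (hL : L.Nodup) {m : ℕ}
    {K : List (ℕ × ℕ)} (hK : (K.map Prod.fst).Nodup) (h1 : checkMask L N op m = true)
    (h2 : checkLabels L N op m K = true) :
    IsBlowup T (fun x => familyLabel m K (code x)) (labelMul N op) K := by
  classical
  simp only [checkLabels, Bool.cond_false_right, Bool.and_eq_true, allIn_eq_true,
    hasLabel_eq_true, Nat.beq_eq] at h2
  obtain ⟨h2, h3, h4⟩ := h2
  have hmul : ∀ x y, labelMul N op (familyLabel m K (code x)) (familyLabel m K (code y)) =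
      2 * code (x * y) + 1 := by
    intro x y
    rw [labelMul_eq, h.code_mul, mulCode_congr h1 (h.mem y) (familyLabel_div_two_land m K _)
      (familyLabel_div_two_land m K _)]
  have hlab : ∀ x y, familyLabel m K (code (x * y)) = 2 * code (x * y) + 1 := by
    intro x y
    obtain ⟨p, hp, hpx⟩ := h2 _ (h.mem x)
    obtain ⟨q, hq, hqy⟩ := h2 _ (h.mem y)
    have := h3 p hp q hq
    rw [hpx, hqy, hmul, ← hasLabel_eq_true] at this
    rw [familyLabel_eq, if_pos this]
  refine ⟨fun x y => by rw [hlab, hmul], fun x y z hz => ?_, hK, fun x => h2 _ (h.mem x),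
    fun p hp => ?_⟩
  · rw [hlab, familyLabel_eq] at hz
    refine h.injective ?_
    split_ifs at hz <;> omega
  · have : Finite T := h.finite
    have : Fintype T := Fintype.ofFinite T
    rw [← h4 p hp, countIn_eq, ← List.toFinset_card_of_nodup (hL.filter _),
      Nat.card_eq_fintype_card, Fintype.card_subtype,
      ← Finset.card_image_of_injective _ h.injective]
    congr 1
    ext F
    simp only [Finset.mem_image, Finset.mem_filter, Finset.mem_univ, true_and, List.mem_toFinset,
      List.mem_filter, Nat.beq_eq]
    constructor
    · rintro ⟨x, hx, rfl⟩
      exact ⟨h.mem x, hx⟩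
    · rintro ⟨hF, hp⟩
      obtain ⟨x, rfl⟩ := h.surj F hF
      exact ⟨x, hp, rfl⟩

/-- Whether no entry of `l` occurs twice. -/
noncomputable def checkNodup (l : List ℕ) : Bool :=
  List.rec true (fun a t ih => cond (allIn t fun b => cond (Nat.beq a b) false true) ih false) l

theorem nodup_of_checkNodup {l : List ℕ} (h : checkNodup l = true) : l.Nodup := by
  induction l with
  | nil => exact List.nodup_nil
  | cons a t ih =>
    have h1 : checkNodup (a :: t) =
      cond (allIn t fun b => cond (Nat.beq a b) false true) (checkNodup t) false := rfl
    rw [h1, Bool.cond_false_right, Bool.and_eq_true, allIn_eq_true] at h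
    refine List.nodup_cons.2 ⟨fun ha => ?_, ih h.2⟩
    simpa using h.1 a ha

/-- The automorphism group of a superextension, read off from a list `K` of labels: it is the
product of the symmetric groups on the sets of families with the same label. -/
theorem IsCoding.nonempty_mulEquiv {T : Type u} [Mul T] {L : List ℕ} {N : ℕ} {op : ℕ → ℕ → ℕ}
    {code : T → ℕ} (h : IsCoding T L (mulCode N op) code) (hL : L.Nodup) {m : ℕ}
    {K : List (ℕ × ℕ)} (hK : checkNodup (K.map Prod.fst) = true) (h1 : checkMask L N op m = true)
    (h2 : checkLabels L N op m K = true) (h3 : checkColors N op K = true)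
    {I : Type} (lab sz : I → ℕ) (hlab : Function.Injective lab) (hsz : ∀ i, (lab i, sz i) ∈ K)
    (hone : ∀ p ∈ K, p.2 = 1 ∨ ∃ i, lab i = p.1) :
    Nonempty (MulAut T ≃* ∀ i, Equiv.Perm (Fin (sz i))) := by
  have : Finite T := h.finite
  refine (h.isBlowup hL (nodup_of_checkNodup hK) h1 h2).nonempty_mulEquiv (fun p hp q hq H => ?_)
    lab sz hlab hsz hone
  have := (allIn_eq_true.1 (allIn_eq_true.1 h3 p hp)) q hq
  rw [← Nat.beq_eq] at H ⊢
  rw [H] at this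
  exact this

/-! ### Powers of a monogenic semigroup -/

/-- The multiplication of the powers `a ^ k, …, a ^ (r + m - 1)` of an element of index `r` and
period `m`, where the number `i` stands for `a ^ (i + k)`. -/
def powerOp (r m k i j : ℕ) : ℕ :=
  cond (Nat.blt (i + j + 2 * k) (r + m)) (i + j + k) (r + (i + j + 2 * k - r) % m - k)

/-- The addition of the cyclic group of order `m`. -/
def cyclicOp (m i j : ℕ) : ℕ := (i + j) % m

theorem pow_add_mul_eq {G : Type u} [Monoid G] {a : G} {r m : ℕ} (h : a ^ (r + m) = a ^ r) {i : ℕ}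
    (hi : r ≤ i) (t : ℕ) : a ^ (i + m * t) = a ^ i := by
  induction t with
  | zero => rfl
  | succ t ih =>
    obtain ⟨d, rfl⟩ := Nat.exists_eq_add_of_le hi
    have h1 : r + d + m * (t + 1) = (r + m) + (d + m * t) := by ring
    rw [h1, pow_add, h, ← pow_add, ← add_assoc, ih]

theorem pow_eq_pow_of_le_of_modEq {G : Type u} [Monoid G] {a : G} {r m : ℕ}
    (h : a ^ (r + m) = a ^ r) {i j : ℕ} (hi : r ≤ i) (hj : r ≤ j)
    (hij : i ≡ j [MOD m]) : a ^ i = a ^ j := by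
  wlog hle : i ≤ j generalizing i j
  · exact (this hj hi hij.symm (le_of_not_ge hle)).symm
  obtain ⟨t, ht⟩ := (Nat.modEq_iff_dvd' hle).1 hij
  have : j = i + m * t := by omega
  rw [this, pow_add_mul_eq h hi]

namespace IsMonogenicOfIndexPeriod

variable {S : Type u} [Semigroup S] {r m : ℕ}

/-- A generator together with its powers: `p n` is the `n`-th power of the generator for `n ≥ 1`. -/
theorem exists_powers (h : IsMonogenicOfIndexPeriod S r m) : ∃ p : ℕ → S,
    (∀ i j, 0 < i → 0 < j → p (i + j) = p i * p j) ∧ (∀ x, ∃ i, 0 < i ∧ p i = x) ∧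
      (∀ i j, r ≤ i → r ≤ j → i ≡ j [MOD m] → p i = p j) ∧
      ∀ i j, 0 < i → 0 < j → i < r + m → j < r + m → p i = p j → i = j := by
  obtain ⟨a, ha, hrm⟩ := h.exists_generator
  have hr := h.index_pos
  have hm := h.period_pos
  let p : ℕ → S := fun n => Nat.rec a (fun _ x => x * a) (n - 1)
  have hp : ∀ n : ℕ, 0 < n → WithOne.coe (p n) = (a : WithOne S) ^ n := by
    intro n hn
    obtain ⟨n, rfl⟩ := Nat.exists_eq_add_of_le' hn
    clear hn
    induction n with
    | zero => exact (pow_one _).symm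
    | succ n ih =>
      rw [pow_succ, ← ih, ← WithOne.coe_mul]
      rfl
  have hmod : ∀ i j, r ≤ i → r ≤ j → i ≡ j [MOD m] → p i = p j := by
    intro i j hi hj hij
    rw [← WithOne.coe_inj, hp i (by omega), hp j (by omega),
      pow_eq_pow_of_le_of_modEq hrm hi hj hij]
  have hsurj : ∀ x, ∃ i, 0 < i ∧ p i = x := by
    intro x
    obtain ⟨n, hn, hx⟩ := ha x
    exact ⟨n, hn, by rw [← WithOne.coe_inj, hp n hn, hx]⟩
  -- The `r + m - 1` first powers exhaust the semigroup, so that they are distinct.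
  have hbij : Function.Bijective fun i : Fin (r + m - 1) => p (i + 1) := by
    have : Finite S := Nat.finite_of_card_ne_zero (by rw [h.card_eq]; omega)
    refine (Nat.bijective_iff_surjective_and_card _).2 ⟨fun x => ?_, ?_⟩
    · obtain ⟨n, hn, rfl⟩ := hsurj x
      by_cases hlt : n < r + m
      · exact ⟨⟨n - 1, by omega⟩, congrArg p (by simp; omega)⟩
      · have hlt' := Nat.mod_lt (n - r) hm
        refine ⟨⟨r + (n - r) % m - 1, by omega⟩, ?_⟩
        have h1 : r + (n - r) % m - 1 + 1 = r + (n - r) % m := by omega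
        change p (r + (n - r) % m - 1 + 1) = p n
        rw [h1]
        refine hmod _ _ (by omega) (by omega) ?_
        have h2 : n = r + (n - r) := by omega
        conv_rhs => rw [h2]
        exact Nat.ModEq.add_left r (Nat.mod_modEq _ _)
    · rw [h.card_eq, Nat.card_eq_fintype_card, Fintype.card_fin]
  refine ⟨p, fun i j hi hj => ?_, hsurj, hmod, fun i j hi hj hi' hj' hij => ?_⟩
  · rw [← WithOne.coe_inj, WithOne.coe_mul, hp _ (by omega), hp i hi, hp j hj, pow_add]
  · have h1 : p (i - 1 + 1) = p (j - 1 + 1) := by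
      rwa [Nat.sub_add_cancel hi, Nat.sub_add_cancel hj]
    have := hbij.1 (a₁ := ⟨i - 1, by omega⟩) (a₂ := ⟨j - 1, by omega⟩) h1
    simp only [Fin.mk.injEq] at this
    omega

end IsMonogenicOfIndexPeriod

theorem mem_prodSet_iff {S : Type u} [Semigroup S] {p : ℕ → S}
    (hp : ∀ i j, 0 < i → 0 < j → p (i + j) = p i * p j) (hs : ∀ x, ∃ i, 0 < i ∧ p i = x) (n : ℕ)
    (x : S) : x ∈ prodSet S n ↔ ∃ i, n < i ∧ p i = x := by
  induction n generalizing x with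
  | zero => exact ⟨fun _ => hs x, fun _ => Set.mem_univ x⟩
  | succ n ih =>
    constructor
    · rintro ⟨y, hy, z, rfl⟩
      obtain ⟨i, hi, rfl⟩ := (ih y).1 hy
      obtain ⟨j, hj, rfl⟩ := hs z
      exact ⟨i + j, by omega, hp i j (by omega) hj⟩
    · rintro ⟨i, hi, rfl⟩
      refine ⟨p (i - 1), (ih _).2 ⟨i - 1, by omega, rfl⟩, p 1, ?_⟩
      rw [← hp _ _ (by omega) one_pos, Nat.sub_add_cancel (by omega)]

/-- If the elements of `U` are the powers `p (ρ i)`, `i < n`, then `U` is `{0, …, n - 1}` with the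
operation `op`. -/
theorem exists_equiv_fin {U S : Type u} [Mul U] [Mul S] {p : ℕ → S} (ι : U → S)
    (hι : Function.Injective ι) (hmul : ∀ x y, ι (x * y) = ι x * ι y) {n : ℕ} (ρ : ℕ → ℕ)
    (hρ : ∀ i < n, ∃ x, ι x = p (ρ i)) (hsurj : ∀ x, ∃ i < n, ι x = p (ρ i))
    (hinj : ∀ i < n, ∀ j < n, p (ρ i) = p (ρ j) → i = j) {op : ℕ → ℕ → ℕ}
    (hop : ∀ i < n, ∀ j < n, op i j < n ∧ p (ρ i) * p (ρ j) = p (ρ (op i j))) :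
    ∃ e : U ≃ Fin n, ∀ x y, (e (x * y) : ℕ) = op (e x) (e y) := by
  choose f hf using fun i : Fin n => hρ i i.2
  have hfb : Function.Bijective f := by
    refine ⟨fun i j hij => Fin.ext (hinj i i.2 j j.2 ?_), fun x => ?_⟩
    · rw [← hf, ← hf, hij]
    · obtain ⟨i, hi, hx⟩ := hsurj x
      exact ⟨⟨i, hi⟩, hι (by rw [hf, hx])⟩
  let e := Equiv.ofBijective f hfb
  have he : ∀ x, ι x = p (ρ (e.symm x)) := fun x => by
    rw [← hf]
    exact congrArg ι (e.apply_symm_apply x).symm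
  refine ⟨e.symm, fun x y => ?_⟩
  obtain ⟨h1, h2⟩ := hop _ (e.symm x).2 _ (e.symm y).2
  exact hinj _ (e.symm (x * y)).2 _ h1 (by rw [← he, hmul, he, he, h2])

namespace IsMonogenicOfIndexPeriod

variable {S : Type u} [Semigroup S] {r m : ℕ}

theorem exists_equiv_powerOp (h : IsMonogenicOfIndexPeriod S r m) {k : ℕ} (hk : 1 ≤ k)
    (hkr : k < r) {U : Type u} [Mul U] (ι : U → S) (hι : Function.Injective ι)
    (hmul : ∀ x y, ι (x * y) = ι x * ι y) (hrange : Set.range ι = prodSet S (k - 1)) :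
    ∃ e : U ≃ Fin (r + m - k), ∀ x y, (e (x * y) : ℕ) = powerOp r m k (e x) (e y) := by
  obtain ⟨p, hp, hs, hmod, hinj⟩ := h.exists_powers
  have hm := h.period_pos
  have hι' : ∀ z, (∃ x, ι x = z) ↔ ∃ i, k - 1 < i ∧ p i = z := fun z => by
    rw [← mem_prodSet_iff hp hs, ← hrange]
    rfl
  have hred : ∀ j, r + m ≤ j → r + (j - r) % m < r + m ∧ p j = p (r + (j - r) % m) := by
    intro j hj
    have hlt := Nat.mod_lt (j - r) hm
    refine ⟨by omega, hmod _ _ (by omega) (by omega) ?_⟩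
    have h2 : j = r + (j - r) := by omega
    conv_lhs => rw [h2]
    exact Nat.ModEq.add_left r (Nat.mod_modEq _ _).symm
  refine exists_equiv_fin ι hι hmul (fun i => i + k) (fun i _ => (hι' _).2 ⟨_, by omega, rfl⟩)
    (fun x => ?_) (fun i hi j hj hij => ?_) (fun i hi j hj => ?_)
  · obtain ⟨j, hj, hx⟩ := (hι' _).1 ⟨x, rfl⟩
    by_cases hlt : j < r + m
    · exact ⟨j - k, by omega, by rw [← hx]; exact congrArg p (by omega)⟩
    · obtain ⟨h1, h2⟩ := hred j (by omega)
      exact ⟨r + (j - r) % m - k, by omega, by rw [← hx, h2]; exact congrArg p (by omega)⟩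
  · have := hinj _ _ (by omega) (by omega) (by omega) (by omega) hij
    omega
  · rw [← hp _ _ (by omega) (by omega)]
    have hE : i + k + (j + k) = i + j + 2 * k := by ring
    rw [hE]
    by_cases hlt : i + j + 2 * k < r + m
    · have hb : Nat.blt (i + j + 2 * k) (r + m) = true := by rwa [Nat.blt_eq]
      have : powerOp r m k i j = i + j + k := by rw [powerOp, hb, cond_true]
      rw [this]
      exact ⟨by omega, congrArg p (by omega)⟩
    · have hb : Nat.blt (i + j + 2 * k) (r + m) = false := by
        rwa [← Bool.not_eq_true, Nat.blt_eq]
      have : powerOp r m k i j = r + (i + j + 2 * k - r) % m - k := by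
        rw [powerOp, hb, cond_false]
      rw [this]
      obtain ⟨h1, h2⟩ := hred (i + j + 2 * k) (by omega)
      exact ⟨by omega, by rw [h2]; exact congrArg p (by omega)⟩

theorem exists_equiv_cyclicOp (h : IsMonogenicOfIndexPeriod S r m) {k : ℕ} (hkr : r ≤ k)
    {U : Type u} [Mul U] (ι : U → S) (hι : Function.Injective ι)
    (hmul : ∀ x y, ι (x * y) = ι x * ι y) (hrange : Set.range ι = prodSet S (k - 1)) :
    ∃ e : U ≃ Fin m, ∀ x y, (e (x * y) : ℕ) = cyclicOp m (e x) (e y) := by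
  obtain ⟨p, hp, hs, hmod, hinj⟩ := h.exists_powers
  have hm := h.period_pos
  have hr := h.index_pos
  have hι' : ∀ z, (∃ x, ι x = z) ↔ ∃ i, k - 1 < i ∧ p i = z := fun z => by
    rw [← mem_prodSet_iff hp hs, ← hrange]
    rfl
  have hmk : k ≤ m * k := Nat.le_mul_of_pos_left k hm
  have hmodk : ∀ i, i + m * k ≡ i [MOD m] := fun i => by simp [Nat.ModEq]
  refine exists_equiv_fin ι hι hmul (fun i => i + m * k)
    (fun i _ => (hι' _).2 ⟨_, by omega, rfl⟩) (fun x => ?_) (fun i hi j hj hij => ?_)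
    (fun i hi j hj => ?_)
  · obtain ⟨j, hj, hx⟩ := (hι' _).1 ⟨x, rfl⟩
    exact ⟨j % m, Nat.mod_lt _ hm, by
      rw [← hx]
      exact hmod _ _ (by omega) (by omega) ((Nat.mod_modEq j m).symm.trans (hmodk _).symm)⟩
  · -- Both exponents are congruent to exponents in the range `r, …, r + m - 1`.
    have hred : ∀ j, r ≤ j → p j = p (r + (j - r) % m) := by
      intro j hj
      refine hmod _ _ hj (by omega) ?_
      have h2 : j = r + (j - r) := by omega
      conv_lhs => rw [h2]
      exact Nat.ModEq.add_left r (Nat.mod_modEq _ _).symm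
    rw [hred (i + m * k) (by omega), hred (j + m * k) (by omega)] at hij
    have h1 := Nat.mod_lt (i + m * k - r) hm
    have h2 := Nat.mod_lt (j + m * k - r) hm
    have h3 := hinj _ _ (by omega) (by omega) (by omega) (by omega) hij
    have h4 : i + m * k - r ≡ j + m * k - r [MOD m] := by
      unfold Nat.ModEq
      omega
    have h5 := h4.add_right r
    rw [Nat.sub_add_cancel (by omega), Nat.sub_add_cancel (by omega)] at h5
    have h6 := ((hmodk i).symm.trans h5).trans (hmodk j)
    exact Nat.ModEq.eq_of_lt_of_lt h6 hi hj
  · refine ⟨Nat.mod_lt _ hm, ?_⟩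
    rw [← hp _ _ (by omega) (by omega)]
    refine hmod _ _ (by omega) (by omega) ?_
    exact ((hmodk i).add (hmodk j)).trans ((Nat.mod_modEq (i + j) m).symm.trans (hmodk _).symm)

end IsMonogenicOfIndexPeriod

/-! ### Automorphism groups computed from labels -/

/-- The families on a disjoint union of index types, as a product. -/
def piSumMulEquiv {A B : Type} (G : A ⊕ B → Type) [∀ i, Mul (G i)] :
    (∀ i, G i) ≃* (∀ a, G (Sum.inl a)) × ∀ b, G (Sum.inr b) :=
  { Equiv.sumPiEquivProdPi G with map_mul' := fun _ _ => rfl }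

theorem nodup_maxLinkedCodes {n : ℕ} (hn : n ≤ 4) : (maxLinkedCodes n).Nodup := by
  interval_cases n <;> exact nodup_of_checkNodup (by decide +kernel)

/-- Whether the entries of `K` are the labels of the maximal linked families on a set with `n + 1`
elements and multiplication `op`, listed once each with the number of families carrying them, in
such a way that products depend only on labels and that refined colours tell labels apart. -/
noncomputable def checkLabelling (n : ℕ) (op : ℕ → ℕ → ℕ) (m : ℕ) (K : List (ℕ × ℕ)) : Bool :=
  cond (checkNodup (K.map Prod.fst))
    (cond (checkMask (maxLinkedCodes n) (n + 1) op m)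
      (cond (checkLabels (maxLinkedCodes n) (n + 1) op m K) (checkColors (n + 1) op K) false) false)
    false

section Labels

variable {U : Type u} [Semigroup U] {n : ℕ} {op : ℕ → ℕ → ℕ}

theorem nonempty_mulEquiv_of_labels (e : U ≃ Fin (n + 1))
    (hop : ∀ x y, (e (x * y) : ℕ) = op (e x) (e y)) (hn : n ≤ 4) {m : ℕ} {K : List (ℕ × ℕ)}
    (hK : checkLabelling n op m K = true)
    {I : Type} (lab sz : I → ℕ) (hlab : Function.Injective lab) (hsz : ∀ i, (lab i, sz i) ∈ K)
    (hone : ∀ p ∈ K, p.2 = 1 ∨ ∃ i, lab i = p.1) :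
    Nonempty (AutSuperext U ≃* ∀ i, SymGrp (sz i)) := by
  obtain ⟨code, hcode⟩ := exists_isCoding e hop
  simp only [checkLabelling, Bool.cond_false_right, Bool.and_eq_true] at hK
  exact hcode.nonempty_mulEquiv (nodup_maxLinkedCodes hn) hK.1 hK.2.1 hK.2.2.1 hK.2.2.2 lab sz hlab
    hsz hone

theorem aut_of_labels_trivial (e : U ≃ Fin (n + 1))
    (hop : ∀ x y, (e (x * y) : ℕ) = op (e x) (e y)) (hn : n ≤ 4) (m : ℕ) (K : List (ℕ × ℕ))
    (hone : ∀ p ∈ K, p.2 = 1) (hK : checkLabelling n op m K = true) :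
    Nonempty (AutSuperext U ≃* CyclicGrp 1) := by
  obtain ⟨φ⟩ := nonempty_mulEquiv_of_labels e hop hn hK (I := Empty) Empty.elim
    Empty.elim (fun i => i.elim) (fun i => i.elim) fun p hp => Or.inl (hone p hp)
  have : Unique (CyclicGrp 1) := inferInstanceAs (Unique (Fin 1))
  exact ⟨φ.trans MulEquiv.ofUnique⟩

theorem aut_of_labels_one (e : U ≃ Fin (n + 1))
    (hop : ∀ x y, (e (x * y) : ℕ) = op (e x) (e y)) (hn : n ≤ 4) (m k s : ℕ) (K : List (ℕ × ℕ))
    (hone : ∀ p ∈ K, p.2 = 1) (hK : checkLabelling n op m ((k, s) :: K) = true) :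
    Nonempty (AutSuperext U ≃* SymGrp s) := by
  obtain ⟨φ⟩ := nonempty_mulEquiv_of_labels e hop hn hK (I := Unit)
    (fun _ => k) (fun _ => s) (fun _ _ _ => rfl) (fun _ => List.mem_cons_self)
    (List.forall_mem_cons.2 ⟨Or.inr ⟨(), rfl⟩, fun p hp => Or.inl (hone p hp)⟩)
  exact ⟨φ.trans (MulEquiv.piUnique _)⟩

theorem aut_of_labels_two (e : U ≃ Fin (n + 1))
    (hop : ∀ x y, (e (x * y) : ℕ) = op (e x) (e y)) (hn : n ≤ 4) (m k s l t : ℕ)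
    (K : List (ℕ × ℕ)) (hkl : k ≠ l) (hone : ∀ p ∈ K, p.2 = 1)
    (hK : checkLabelling n op m ((k, s) :: (l, t) :: K) = true) :
    Nonempty (AutSuperext U ≃* (SymGrp s × SymGrp t)) := by
  obtain ⟨φ⟩ := nonempty_mulEquiv_of_labels e hop hn hK (I := Unit ⊕ Unit)
    (Sum.elim (fun _ => k) fun _ => l) (Sum.elim (fun _ => s) fun _ => t)
    (by rintro (_ | _) (_ | _) h <;> first | rfl | exact absurd h hkl | exact absurd h.symm hkl)
    (by rintro (_ | _) <;> simp)
    (List.forall_mem_cons.2 ⟨Or.inr ⟨.inl (), rfl⟩,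
      List.forall_mem_cons.2 ⟨Or.inr ⟨.inr (), rfl⟩, fun p hp => Or.inl (hone p hp)⟩⟩)
  exact ⟨φ.trans ((piSumMulEquiv _).trans
    ((MulEquiv.piUnique _).prodCongr (MulEquiv.piUnique _)))⟩

/-- The case of eight labels carried by several families, three of them by `s` families each and two
by `s'` families each. The labels are indexed by a disjoint union that reflects the grouping of the
factors. -/
theorem aut_of_labels_five (e : U ≃ Fin (n + 1))
    (hop : ∀ x y, (e (x * y) : ℕ) = op (e x) (e y)) (hn : n ≤ 4) (m : ℕ) (K : List (ℕ × ℕ))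
    (a : Fin 3 → ℕ) (b : ℕ) (c : Fin 2 → ℕ) (d d' s t s' t' t'' : ℕ)
    (hlab : Function.Injective (Sum.elim a (Sum.elim (fun _ : Unit => b)
      (Sum.elim c (Sum.elim (fun _ : Unit => d) fun _ : Unit => d')))))
    (hsz : (∀ i, (a i, s) ∈ K) ∧ (b, t) ∈ K ∧ (∀ i, (c i, s') ∈ K) ∧ (d, t') ∈ K ∧ (d', t'') ∈ K)
    (hone : ∀ p ∈ K, p.2 = 1 ∨ (∃ i, a i = p.1) ∨ b = p.1 ∨ (∃ i, c i = p.1) ∨ d = p.1 ∨ d' = p.1)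
    (hK : checkLabelling n op m K = true) :
    Nonempty (AutSuperext U ≃* ((Fin 3 → SymGrp s) × SymGrp t × (Fin 2 → SymGrp s') ×
      SymGrp t' × SymGrp t'')) := by
  obtain ⟨ha, hb, hc, hd, hd'⟩ := hsz
  obtain ⟨φ⟩ := nonempty_mulEquiv_of_labels e hop hn hK _
    (Sum.elim (fun _ => s) (Sum.elim (fun _ => t) (Sum.elim (fun _ => s')
      (Sum.elim (fun _ => t') fun _ => t'')))) hlab
    (by rintro (i | i | i | i | i); exacts [ha i, hb, hc i, hd, hd'])
    (fun p hp => (hone p hp).imp_right (by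
      rintro (⟨i, h⟩ | h | ⟨i, h⟩ | h | h)
      exacts [⟨.inl i, h⟩, ⟨.inr (.inl ()), h⟩, ⟨.inr (.inr (.inl i)), h⟩,
        ⟨.inr (.inr (.inr (.inl ()))), h⟩, ⟨.inr (.inr (.inr (.inr ()))), h⟩]))
  exact ⟨φ.trans ((piSumMulEquiv _).trans ((MulEquiv.refl _).prodCongr ((piSumMulEquiv _).trans
    ((MulEquiv.piUnique _).prodCongr ((piSumMulEquiv _).trans ((MulEquiv.refl _).prodCongr
      ((piSumMulEquiv _).trans ((MulEquiv.piUnique _).prodCongr (MulEquiv.piUnique _)))))))))⟩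

end Labels

theorem nonempty_perm_two_mulEquiv : Nonempty (SymGrp 2 ≃* CyclicGrp 2) :=
  ⟨mulEquivOfPrimeCardEq (p := 2) (by simp [Nat.card_eq_fintype_card, Fintype.card_perm]) (by simp)⟩

/-!
In the following theorems, the first number is the mask selecting the sets on which products depend,
as in `familyLabel`. A label carried by several families is accompanied by the number of these
families.
-/

section Cases

variable {U : Type u} [Semigroup U]

theorem aut_cyclicOp_one (e : U ≃ Fin 1)
    (hop : ∀ x y, (e (x * y) : ℕ) = cyclicOp 1 (e x) (e y)) :
    Nonempty (AutSuperext U ≃* CyclicGrp 1) :=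
  aut_of_labels_trivial e hop (by decide) 3
    [(5, 1)]
    (by decide +kernel) (by decide +kernel)

theorem aut_cyclicOp_two (e : U ≃ Fin 2)
    (hop : ∀ x y, (e (x * y) : ℕ) = cyclicOp 2 (e x) (e y)) :
    Nonempty (AutSuperext U ≃* CyclicGrp 1) :=
  aut_of_labels_trivial e hop (by decide) 15
    [(21, 1), (25, 1)]
    (by decide +kernel) (by decide +kernel)

theorem aut_powerOp_2_1_1 (e : U ≃ Fin 2)
    (hop : ∀ x y, (e (x * y) : ℕ) = powerOp 2 1 1 (e x) (e y)) :
    Nonempty (AutSuperext U ≃* CyclicGrp 1) :=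
  aut_of_labels_trivial e hop (by decide) 9
    [(16, 1), (25, 1)]
    (by decide +kernel) (by decide +kernel)

theorem aut_powerOp_2_2_1 (e : U ≃ Fin 3)
    (hop : ∀ x y, (e (x * y) : ℕ) = powerOp 2 2 1 (e x) (e y)) :
    Nonempty (AutSuperext U ≃* CyclicGrp 2) :=
  nonempty_perm_two_mulEquiv.elim fun ψ => Nonempty.map (·.trans ψ)
    (aut_of_labels_one e hop (by decide) 165 320 2
      [(409, 1), (481, 1)]
      (by decide +kernel) (by decide +kernel))

theorem aut_powerOp_3_1_1 (e : U ≃ Fin 3)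
    (hop : ∀ x y, (e (x * y) : ℕ) = powerOp 3 1 1 (e x) (e y)) :
    Nonempty (AutSuperext U ≃* CyclicGrp 1) :=
  aut_of_labels_trivial e hop (by decide) 195
    [(260, 1), (384, 1), (409, 1), (481, 1)]
    (by decide +kernel) (by decide +kernel)

theorem aut_powerOp_3_1_2 (e : U ≃ Fin 2)
    (hop : ∀ x y, (e (x * y) : ℕ) = powerOp 3 1 2 (e x) (e y)) :
    Nonempty (AutSuperext U ≃* CyclicGrp 1) :=
  aut_of_labels_trivial e hop (by decide) 9
    [(16, 1), (25, 1)]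
    (by decide +kernel) (by decide +kernel)

theorem aut_powerOp_2_3_1 (e : U ≃ Fin 4)
    (hop : ∀ x y, (e (x * y) : ℕ) = powerOp 2 3 1 (e x) (e y)) :
    Nonempty (AutSuperext U ≃* (SymGrp 3 × SymGrp 5)) :=
  aut_of_labels_two e hop (by decide) 43605 86144 3 87040 5
    [(104857, 1), (123361, 1), (129409, 1), (130561, 1)]
    (by decide +kernel) (by decide +kernel) (by decide +kernel)

theorem aut_powerOp_3_2_1 (e : U ≃ Fin 4)
    (hop : ∀ x y, (e (x * y) : ℕ) = powerOp 3 2 1 (e x) (e y)) :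
    Nonempty (AutSuperext U ≃* (SymGrp 3 × SymGrp 4)) :=
  aut_of_labels_two e hop (by decide) 52275 104448 3 102464 4
    [(69700, 1), (104857, 1), (123361, 1), (129409, 1), (130561, 1)]
    (by decide +kernel) (by decide +kernel) (by decide +kernel)

theorem aut_powerOp_3_2_2 (e : U ≃ Fin 3)
    (hop : ∀ x y, (e (x * y) : ℕ) = powerOp 3 2 2 (e x) (e y)) :
    Nonempty (AutSuperext U ≃* CyclicGrp 2) :=
  nonempty_perm_two_mulEquiv.elim fun ψ => Nonempty.map (·.trans ψ)
    (aut_of_labels_one e hop (by decide) 165 320 2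
      [(409, 1), (481, 1)]
      (by decide +kernel) (by decide +kernel))

theorem aut_powerOp_4_1_1 (e : U ≃ Fin 4)
    (hop : ∀ x y, (e (x * y) : ℕ) = powerOp 4 1 1 (e x) (e y)) :
    Nonempty (AutSuperext U ≃* (SymGrp 3 × SymGrp 4)) :=
  aut_of_labels_two e hop (by decide) 61455 122880 3 114704 4
    [(81940, 1), (104857, 1), (123361, 1), (129409, 1), (130561, 1)]
    (by decide +kernel) (by decide +kernel) (by decide +kernel)

theorem aut_powerOp_4_1_2 (e : U ≃ Fin 3)
    (hop : ∀ x y, (e (x * y) : ℕ) = powerOp 4 1 2 (e x) (e y)) :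
    Nonempty (AutSuperext U ≃* SymGrp 3) :=
  aut_of_labels_one e hop (by decide) 129 256 3
    [(481, 1)]
    (by decide +kernel) (by decide +kernel)

theorem aut_powerOp_4_1_3 (e : U ≃ Fin 2)
    (hop : ∀ x y, (e (x * y) : ℕ) = powerOp 4 1 3 (e x) (e y)) :
    Nonempty (AutSuperext U ≃* CyclicGrp 1) :=
  aut_of_labels_trivial e hop (by decide) 9
    [(16, 1), (25, 1)]
    (by decide +kernel) (by decide +kernel)

theorem aut_powerOp_2_4_1 (e : U ≃ Fin 5)
    (hop : ∀ x y, (e (x * y) : ℕ) = powerOp 2 4 1 (e x) (e y)) :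
    Nonempty (AutSuperext U ≃* ((Fin 3 → SymGrp 3) × (Fin 3 → SymGrp 8) ×
      SymGrp 17 × SymGrp 19)) := by
  obtain ⟨φ⟩ := nonempty_mulEquiv_of_labels e hop (by decide) (m := 2863289685)
    (K := [(5655005312, 3), (5658157184, 3), (5721073664, 3), (5659197568, 8), (5722114048, 8),
      (5725265920, 8), (5726306304, 17), (5726535680, 19), (6871947673, 1), (8084644321, 1),
      (8481012097, 1), (8482560385, 1), (8487297409, 1), (8488845697, 1), (8556510721, 1),
      (8581675009, 1), (8583223297, 1), (8587960321, 1), (8589508609, 1), (8589803521, 1)])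
    (by decide +kernel) (I := Fin 3 ⊕ Fin 3 ⊕ Unit ⊕ Unit)
    (Sum.elim ![5655005312, 5658157184, 5721073664]
      (Sum.elim ![5659197568, 5722114048, 5725265920]
        (Sum.elim (fun _ => 5726306304) fun _ => 5726535680)))
    (Sum.elim (fun _ => 3) (Sum.elim (fun _ => 8) (Sum.elim (fun _ => 17) fun _ => 19)))
    (by decide +kernel) (by decide +kernel) (by decide +kernel)
  exact ⟨φ.trans ((piSumMulEquiv _).trans ((MulEquiv.refl _).prodCongr ((piSumMulEquiv _).trans
    ((MulEquiv.refl _).prodCongr ((piSumMulEquiv _).trans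
      ((MulEquiv.piUnique _).prodCongr (MulEquiv.piUnique _)))))))⟩

theorem aut_powerOp_3_3_1 (e : U ≃ Fin 5)
    (hop : ∀ x y, (e (x * y) : ℕ) = powerOp 3 3 1 (e x) (e y)) :
    Nonempty (AutSuperext U ≃* ((Fin 3 → SymGrp 4) × SymGrp 5 × (Fin 2 → SymGrp 9) ×
      SymGrp 14 × SymGrp 18)) :=
  aut_of_labels_five e hop (by decide) 3435934515
    [(6728729664, 4), (6736076864, 4), (6861906944, 4), (6870294528, 5), (6737117248, 9),
    (6862947328, 9), (6871842816, 14), (6871334912, 18), (4581246020, 1), (6727689280, 1),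
    (6871947673, 1), (8084644321, 1), (8481012097, 1), (8482560385, 1), (8487297409, 1),
    (8488845697, 1), (8556510721, 1), (8581675009, 1), (8583223297, 1), (8587960321, 1),
    (8589508609, 1), (8589803521, 1)]
    ![6728729664, 6736076864, 6861906944] 6870294528 ![6737117248, 6862947328] 6871842816
    6871334912 4 5 9 14 18
    (by decide +kernel) (by decide +kernel) (by decide +kernel) (by decide +kernel)

theorem aut_powerOp_3_3_2 (e : U ≃ Fin 4)
    (hop : ∀ x y, (e (x * y) : ℕ) = powerOp 3 3 2 (e x) (e y)) :
    Nonempty (AutSuperext U ≃* (SymGrp 3 × SymGrp 5)) :=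
  aut_of_labels_two e hop (by decide) 43605 86144 3 87040 5
    [(104857, 1), (123361, 1), (129409, 1), (130561, 1)]
    (by decide +kernel) (by decide +kernel) (by decide +kernel)

theorem aut_powerOp_4_2_1 (e : U ≃ Fin 5)
    (hop : ∀ x y, (e (x * y) : ℕ) = powerOp 4 2 1 (e x) (e y)) :
    Nonempty (AutSuperext U ≃* ((Fin 3 → SymGrp 4) × SymGrp 5 × (Fin 2 → SymGrp 9) ×
      SymGrp 14 × SymGrp 18)) :=
  aut_of_labels_five e hop (by decide) 4042264335
    [(7537169424, 4), (7541364752, 4), (8069848064, 4), (8078235648, 5), (7545557008, 9),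
    (8074040320, 9), (8084520960, 14), (8082427904, 18), (5389685780, 1), (6871947673, 1),
    (7532977168, 1), (8084644321, 1), (8481012097, 1), (8482560385, 1), (8487297409, 1),
    (8488845697, 1), (8556510721, 1), (8581675009, 1), (8583223297, 1), (8587960321, 1),
    (8589508609, 1), (8589803521, 1)]
    ![7537169424, 7541364752, 8069848064] 8078235648 ![7545557008, 8074040320] 8084520960
    8082427904 4 5 9 14 18
    (by decide +kernel) (by decide +kernel) (by decide +kernel) (by decide +kernel)

theorem aut_powerOp_4_2_2 (e : U ≃ Fin 4)
    (hop : ∀ x y, (e (x * y) : ℕ) = powerOp 4 2 2 (e x) (e y)) :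
    Nonempty (AutSuperext U ≃* (SymGrp 5 × SymGrp 5)) :=
  aut_of_labels_two e hop (by decide) 33825 65600 5 67584 5
    [(123361, 1), (130561, 1)]
    (by decide +kernel) (by decide +kernel) (by decide +kernel)

theorem aut_powerOp_4_2_3 (e : U ≃ Fin 3)
    (hop : ∀ x y, (e (x * y) : ℕ) = powerOp 4 2 3 (e x) (e y)) :
    Nonempty (AutSuperext U ≃* CyclicGrp 2) :=
  nonempty_perm_two_mulEquiv.elim fun ψ => Nonempty.map (·.trans ψ)
    (aut_of_labels_one e hop (by decide) 165 320 2
      [(409, 1), (481, 1)]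
      (by decide +kernel) (by decide +kernel))

theorem aut_powerOp_5_1_1 (e : U ≃ Fin 5)
    (hop : ∀ x y, (e (x * y) : ℕ) = powerOp 5 1 1 (e x) (e y)) :
    Nonempty (AutSuperext U ≃* ((Fin 3 → SymGrp 4) × SymGrp 5 × (Fin 2 → SymGrp 9) ×
      SymGrp 14 × SymGrp 18)) :=
  aut_of_labels_five e hop (by decide) 4278190335
    [(7851737424, 4), (7918846352, 4), (8321499584, 4), (8455717248, 5), (7985955088, 9),
    (8388608320, 9), (8556380160, 14), (8522825984, 18), (5704253780, 1), (6871947673, 1),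
    (7784628688, 1), (8084644321, 1), (8481012097, 1), (8482560385, 1), (8487297409, 1),
    (8488845697, 1), (8556510721, 1), (8581675009, 1), (8583223297, 1), (8587960321, 1),
    (8589508609, 1), (8589803521, 1)]
    ![7851737424, 7918846352, 8321499584] 8455717248 ![7985955088, 8388608320] 8556380160
    8522825984 4 5 9 14 18
    (by decide +kernel) (by decide +kernel) (by decide +kernel) (by decide +kernel)

theorem aut_powerOp_5_1_2 (e : U ≃ Fin 4)
    (hop : ∀ x y, (e (x * y) : ℕ) = powerOp 5 1 2 (e x) (e y)) :
    Nonempty (AutSuperext U ≃* SymGrp 9) :=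
  aut_of_labels_one e hop (by decide) 49155 98304 9
    [(65540, 1), (123361, 1), (130561, 1)]
    (by decide +kernel) (by decide +kernel)

theorem aut_powerOp_5_1_3 (e : U ≃ Fin 3)
    (hop : ∀ x y, (e (x * y) : ℕ) = powerOp 5 1 3 (e x) (e y)) :
    Nonempty (AutSuperext U ≃* SymGrp 3) :=
  aut_of_labels_one e hop (by decide) 129 256 3
    [(481, 1)]
    (by decide +kernel) (by decide +kernel)

theorem aut_powerOp_5_1_4 (e : U ≃ Fin 2)
    (hop : ∀ x y, (e (x * y) : ℕ) = powerOp 5 1 4 (e x) (e y)) :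
    Nonempty (AutSuperext U ≃* CyclicGrp 1) :=
  aut_of_labels_trivial e hop (by decide) 9
    [(16, 1), (25, 1)]
    (by decide +kernel) (by decide +kernel)

end Cases

/-! ### Automorphisms in terms of codes -/

/-- `f` is an automorphism of the magma formed by the numbers in `L` with multiplication `mul`. -/
structure IsCodeAut (L : List ℕ) (mul : ℕ → ℕ → ℕ) (f : ℕ → ℕ) : Prop where
  mem : ∀ F ∈ L, f F ∈ L
  inj : ∀ F ∈ L, ∀ G ∈ L, f F = f G → F = G
  surj : ∀ G ∈ L, ∃ F ∈ L, f F = G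
  map_mul : ∀ F ∈ L, ∀ G ∈ L, f (mul F G) = mul (f F) (f G)

/-- A left identity is fixed by automorphisms if there is no other. -/
theorem IsCodeAut.map_one {L : List ℕ} {mul : ℕ → ℕ → ℕ} {f : ℕ → ℕ} (hf : IsCodeAut L mul f)
    {o : ℕ} (ho : o ∈ L) (h1 : ∀ Y ∈ L, mul o Y = Y)
    (h2 : ∀ X ∈ L, (∀ Y ∈ L, mul X Y = Y) → X = o) : f o = o := by
  refine h2 _ (hf.mem o ho) fun Y hY => ?_
  obtain ⟨F, hF, rfl⟩ := hf.surj Y hY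
  rw [← hf.map_mul o ho F hF, h1 F hF]

namespace IsCoding

variable {T : Type u} [Mul T] {L : List ℕ} {mul : ℕ → ℕ → ℕ} {code : T → ℕ}

theorem mul_mem (h : IsCoding T L mul code) {F G : ℕ} (hF : F ∈ L) (hG : G ∈ L) : mul F G ∈ L := by
  obtain ⟨x, rfl⟩ := h.surj F hF
  obtain ⟨y, rfl⟩ := h.surj G hG
  rw [← h.code_mul]
  exact h.mem _

theorem exists_isCodeAut (h : IsCoding T L mul code) (φ : MulAut T) :
    ∃ f, IsCodeAut L mul f ∧ ∀ x, code (φ x) = f (code x) := by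
  let f : ℕ → ℕ := Function.extend code (fun x => code (φ x)) id
  have hf : ∀ x, f (code x) = code (φ x) := h.injective.extend_apply _ _
  refine ⟨f, ⟨fun F hF => ?_, fun F hF G hG hFG => ?_, fun G hG => ?_, fun F hF G hG => ?_⟩,
    fun x => (hf x).symm⟩
  · obtain ⟨x, rfl⟩ := h.surj F hF
    rw [hf]
    exact h.mem _
  · obtain ⟨x, rfl⟩ := h.surj F hF
    obtain ⟨y, rfl⟩ := h.surj G hG
    rw [hf, hf] at hFG
    rw [φ.injective (h.injective hFG)]
  · obtain ⟨x, rfl⟩ := h.surj G hG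
    exact ⟨code (φ.symm x), h.mem _, by rw [hf, MulEquiv.apply_symm_apply]⟩
  · obtain ⟨x, rfl⟩ := h.surj F hF
    obtain ⟨y, rfl⟩ := h.surj G hG
    rw [hf, hf, ← h.code_mul, hf, _root_.map_mul, h.code_mul]

theorem exists_mulAut (h : IsCoding T L mul code) (π π' : ℕ → ℕ) (h1 : ∀ F ∈ L, π F ∈ L)
    (h2 : ∀ F ∈ L, π' (π F) = F) (h3 : ∀ F ∈ L, ∀ G ∈ L, π (mul F G) = mul (π F) (π G)) :
    ∃ ψ : MulAut T, ∀ x, code (ψ x) = π (code x) := by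
  have : Finite T := h.finite
  choose f hf using fun x : T => h.surj _ (h1 _ (h.mem x))
  have hinj : Function.Injective f := by
    intro x y hxy
    refine h.injective ?_
    rw [← h2 _ (h.mem x), ← h2 _ (h.mem y), ← hf, ← hf, hxy]
  refine ⟨MulEquiv.mk (Equiv.ofBijective f (Finite.injective_iff_bijective.1 hinj)) fun x y => ?_,
    hf⟩
  refine h.injective ?_
  change code (f (x * y)) = code (f x * f y)
  rw [h.code_mul, hf, hf, hf, h.code_mul, h3 _ (h.mem x) _ (h.mem y)]

theorem eq_one_of_code (h : IsCoding T L mul code) {φ : MulAut T} {f : ℕ → ℕ}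
    (hφ : ∀ x, code (φ x) = f (code x)) (hf : ∀ F ∈ L, f F = F) : φ = 1 :=
  MulEquiv.ext fun x => h.injective (by rw [hφ, hf _ (h.mem x)]; rfl)

end IsCoding

theorem finite_and_card_le_length {G α : Type*} (β : G → α) (hβ : Function.Injective β) (l : List α)
    (hl : ∀ g, β g ∈ l) : Finite G ∧ Nat.card G ≤ l.length := by
  classical
  let γ : G → {a // a ∈ l.toFinset} := fun g => ⟨β g, List.mem_toFinset.2 (hl g)⟩
  have hγ : Function.Injective γ := fun g g' hg => hβ (congrArg Subtype.val hg)
  refine ⟨Finite.of_injective γ hγ, (Nat.card_le_card_of_injective γ hγ).trans ?_⟩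
  rw [Nat.card_eq_fintype_card, Fintype.card_coe]
  exact List.toFinset_card_le l

theorem mulAut_injective_of_rigid {T I : Type*} [Mul T] (p : I → T)
    (h : ∀ φ : MulAut T, (∀ i, φ (p i) = p i) → φ = 1) :
    Function.Injective fun (φ : MulAut T) i => φ (p i) := by
  intro φ ψ hφψ
  have h1 : ψ⁻¹ * φ = 1 := h _ fun i => by
    have := congrFun hφψ i
    simp only at this
    rw [MulAut.mul_apply, this, MulAut.inv_apply_self]
  exact (inv_mul_eq_one.1 h1).symm

/-- The code of the image of the family with code `F` under the map `σ` of `{0, …, N - 1}` to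
itself: a set belongs to the image if its preimage under `σ` belongs to the family. -/
noncomputable def relabel (N : ℕ) (σ : ℕ → ℕ) (F : ℕ) : ℕ :=
  bits (2 ^ N) fun C => bit F (bits N fun b => bit C (σ b))

theorem testBit_relabel (N : ℕ) (σ : ℕ → ℕ) (F C : ℕ) : (relabel N σ F).testBit C =
    (decide (C < 2 ^ N) && F.testBit (bits N fun b => bit C (σ b))) := by
  unfold relabel
  simp only [bit_eq F]
  exact testBit_bits (2 ^ N) (fun C => F.testBit (bits N fun b => bit C (σ b))) C

/-- Endomorphisms of a semigroup induce endomorphisms of the superextension. -/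
theorem relabel_mulCode {N : ℕ} {op : ℕ → ℕ → ℕ} {σ : ℕ → ℕ} (h1 : ∀ a < N, σ a < N)
    (h2 : ∀ a < N, ∀ b < N, op a b < N ∧ σ (op a b) = op (σ a) (σ b)) (F G : ℕ) :
    relabel N σ (mulCode N op F G) = mulCode N op (relabel N σ F) (relabel N σ G) := by
  have hpre : ∀ C b, (bits N fun b => bit C (σ b)).testBit b =
      (decide (b < N) && C.testBit (σ b)) := by
    intro C b
    simp only [bit_eq C]
    exact testBit_bits N (fun b => C.testBit (σ b)) b
  have hlt : ∀ C, (bits N fun b => bit C (σ b)) < 2 ^ N := fun C =>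
    lt_two_pow_of_testBit fun b hb => by rw [hpre]; simp [hb]
  have hin : ∀ C, (bits N fun b => bit (innerCode N op (relabel N σ G) C) (σ b)) =
      innerCode N op G (bits N fun b => bit C (σ b)) := by
    intro C
    refine Nat.eq_of_testBit_eq fun a => ?_
    rw [hpre, testBit_innerCode, testBit_innerCode]
    by_cases ha : a < N
    · simp only [ha, h1 a ha, decide_true, Bool.true_and]
      rw [testBit_relabel]
      simp only [preCode_lt, decide_true, Bool.true_and]
      congr 1
      refine Nat.eq_of_testBit_eq fun b => ?_
      rw [hpre, testBit_preCode, testBit_preCode]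
      by_cases hb : b < N
      · simp only [hb, h1 b hb, decide_true, Bool.true_and]
        rw [hpre, (h2 a ha b hb).2]
        simp [(h2 a ha b hb).1]
      · simp [hb]
    · simp [ha]
  refine Nat.eq_of_testBit_eq fun C => ?_
  rw [testBit_relabel, testBit_mulCode, testBit_mulCode]
  by_cases hC : C < 2 ^ N
  · simp only [hC, hlt, decide_true, Bool.true_and]
    rw [testBit_relabel, hin]
    simp [innerCode_lt]
  · simp [hC]

/-- The elements `G, a * G, …, a ^ (n - 1) * G`. -/
noncomputable def orbitList (mul : ℕ → ℕ → ℕ) (a n : ℕ) (G : ℕ) : List ℕ :=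
  Nat.rec (fun _ => []) (fun _ ih G => G :: force (mul a G) ih) n G

theorem IsCodeAut.fixes_orbitList {L : List ℕ} {mul : ℕ → ℕ → ℕ} {f : ℕ → ℕ}
    (hf : IsCodeAut L mul f) (hmul : ∀ F ∈ L, ∀ G ∈ L, mul F G ∈ L) {a : ℕ} (ha : a ∈ L)
    (hfa : f a = a) (n : ℕ) {G : ℕ} (hG : G ∈ L) (hfG : f G = G) :
    ∀ F ∈ orbitList mul a n G, f F = F := by
  induction n generalizing G with
  | zero => exact fun F hF => absurd hF (List.not_mem_nil)
  | succ n ih =>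
    have h : orbitList mul a (n + 1) G = G :: orbitList mul a n (mul a G) := by
      change G :: force (mul a G) (orbitList mul a n) = _
      rw [force_eq]
    rw [h, List.forall_mem_cons]
    exact ⟨hfG, ih (hmul a ha G hG) (by rw [hf.map_mul a ha G hG, hfa, hfG])⟩

/-! ### The cyclic group of order three -/

/-- The product of codes of maximal linked upfamilies on the cyclic group of order `N`. -/
noncomputable abbrev cyclicMul (N : ℕ) : ℕ → ℕ → ℕ := mulCode N (cyclicOp N)

section Three

/-- An automorphism fixing the principal ultrafilter at the generator, whose code is `204`, fixes
the three principal ultrafilters. The only other family is the zero of the superextension. -/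
theorem fixes_of_fixes_generator_three {f : ℕ → ℕ}
    (hf : IsCodeAut (maxLinkedCodes 2) (cyclicMul 3) f)
    (hmul : ∀ F ∈ maxLinkedCodes 2, ∀ G ∈ maxLinkedCodes 2,
      cyclicMul 3 F G ∈ maxLinkedCodes 2) (hA : f 204 = 204) :
    ∀ F ∈ maxLinkedCodes 2, f F = F := by
  -- The family of sets with at least two elements is the zero of the superextension.
  have hZ : f 232 = 232 := by
    have h1 : ∀ X ∈ maxLinkedCodes 2, (∀ Y ∈ maxLinkedCodes 2, cyclicMul 3 X Y = X) →
      X = 232 := by decide +kernel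
    refine h1 _ (hf.mem _ (by decide +kernel)) fun Y hY => ?_
    obtain ⟨F, hF, rfl⟩ := hf.surj Y hY
    rw [← hf.map_mul _ (by decide +kernel) F hF]
    have h2 : ∀ Y ∈ maxLinkedCodes 2, cyclicMul 3 232 Y = 232 := by decide +kernel
    rw [h2 F hF]
  have h3 := hf.fixes_orbitList hmul (by decide +kernel) hA 3 (by decide +kernel) hA
  have h4 : ∀ F ∈ maxLinkedCodes 2, F ∈ orbitList (cyclicMul 3) 204 3 204 ∨ F = 232 := by
    decide +kernel
  intro F hF
  rcases h4 F hF with h | rfl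
  · exact h3 F h
  · exact hZ

theorem aut_cyclicOp_three {U : Type u} [Semigroup U] (e : U ≃ Fin 3)
    (hop : ∀ x y, (e (x * y) : ℕ) = cyclicOp 3 (e x) (e y)) :
    Nonempty (AutSuperext U ≃* CyclicGrp 2) := by
  obtain ⟨code, h⟩ : ∃ code, IsCoding (Superextension U) (maxLinkedCodes 2) (cyclicMul 3) code :=
    exists_isCoding e hop
  obtain ⟨a, ha⟩ := h.surj 204 (by decide +kernel)
  have hinj : Function.Injective fun (φ : AutSuperext U) (_ : Unit) => φ a :=
    mulAut_injective_of_rigid _ fun φ hφ => by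
      obtain ⟨f, hf, hφf⟩ := h.exists_isCodeAut φ
      refine h.eq_one_of_code hφf
        (fixes_of_fixes_generator_three hf (fun _ hF _ hG => h.mul_mem hF hG) ?_)
      rw [← ha, ← hφf, hφ ()]
  obtain ⟨hfin, hcard⟩ := finite_and_card_le_length (fun φ : AutSuperext U => code (φ a))
    (fun φ ψ hφψ => hinj (funext fun _ => h.injective hφψ)) [204, 240] fun φ => by
      obtain ⟨f, hf, hφf⟩ := h.exists_isCodeAut φ
      -- The two principal ultrafilters at generators are the only families that are not idempotent.
      have h1 : ∀ X ∈ maxLinkedCodes 2, cyclicMul 3 X X ≠ X → X ∈ [204, 240] := by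
        decide +kernel
      change code (φ a) ∈ _
      rw [hφf, ha]
      have hA : 204 ∈ maxLinkedCodes 2 := by decide +kernel
      refine h1 _ (hf.mem _ hA) fun h2 => ?_
      rw [← hf.map_mul _ hA _ hA] at h2
      exact absurd (hf.inj _ (h.mul_mem hA hA) _ hA h2) (by decide +kernel)
  -- The automorphism induced by inversion in the cyclic group.
  obtain ⟨ψ, hψ⟩ := h.exists_mulAut (relabel 3 fun b => 2 * b % 3) (relabel 3 fun b => 2 * b % 3)
    (by decide +kernel) (by decide +kernel)
    fun F _ G _ => relabel_mulCode (by decide) (by decide) F G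
  have hψ1 : ψ ≠ 1 := by
    rintro rfl
    have h1 := hψ a
    rw [ha] at h1
    change code a = _ at h1
    rw [ha] at h1
    exact absurd h1 (by decide +kernel)
  have hc : Nat.card (AutSuperext U) = 2 := by
    have : Nontrivial (AutSuperext U) := ⟨ψ, 1, hψ1⟩
    have := Finite.one_lt_card (α := AutSuperext U)
    simp only [List.length_cons, List.length_nil] at hcard
    omega
  exact ⟨mulEquivOfPrimeCardEq (p := 2) hc (by simp)⟩

end Three

/-! ### The cyclic group of order four -/

/-- A group with at most four elements and two distinct involutions is a Klein four-group. -/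
theorem nonempty_mulEquiv_klein {G : Type*} [Group G] [Finite G] (hcard : Nat.card G ≤ 4)
    {x y : G} (hx : x * x = 1) (hy : y * y = 1) (hx1 : x ≠ 1) (hy1 : y ≠ 1) (hxy : x ≠ y) :
    Nonempty (G ≃* CyclicGrp 2 × CyclicGrp 2) := by
  classical
  have := Fintype.ofFinite G
  have hox : orderOf x = 2 := orderOf_eq_prime (by rw [pow_two, hx]) hx1
  have hoy : orderOf y = 2 := orderOf_eq_prime (by rw [pow_two, hy]) hy1
  have h4 : Nat.card G = 4 := by
    have h1 : 2 ∣ Nat.card G := hox ▸ orderOf_dvd_natCard x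
    have h2 : ({1, x, y} : Finset G).card ≤ Fintype.card G := Finset.card_le_univ _
    rw [Finset.card_eq_three.2 ⟨1, x, y, hx1.symm, hy1.symm, hxy, rfl⟩,
      ← Nat.card_eq_fintype_card] at h2
    omega
  have hnc : ¬ IsCyclic G := by
    intro hc
    have h1 := IsCyclic.card_orderOf_eq_totient (α := G) (d := 2)
      (by rw [← Nat.card_eq_fintype_card, h4]; decide)
    rw [Nat.totient_two, Finset.card_eq_one] at h1
    obtain ⟨z, hz⟩ := h1
    have h2 : ∀ g : G, orderOf g = 2 → g = z := fun g hg =>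
      Finset.mem_singleton.1 (hz ▸ Finset.mem_filter.2 ⟨Finset.mem_univ _, hg⟩)
    exact hxy ((h2 x hox).trans (h2 y hoy).symm)
  have hG : IsKleinFour G :=
    ⟨h4, (not_isCyclic_iff_exponent_eq_prime (p := 2) Nat.prime_two (by rw [h4]; rfl)).1 hnc⟩
  have hC : IsKleinFour (CyclicGrp 2 × CyclicGrp 2) := by
    refine ⟨by simp, ?_⟩
    rw [Monoid.exponent_prod, IsCyclic.exponent_eq_card]
    simp
  exact IsKleinFour.nonempty_mulEquiv

section Four

/-- An automorphism fixing the principal ultrafilter at the generator, whose code is `52428`, and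
the family with code `64704` is trivial: every family is a translate of a principal ultrafilter, of
the family with code `64704` or of its square, the idempotent with code `60072`. -/
theorem fixes_of_fixes_generator_four {f : ℕ → ℕ}
    (hf : IsCodeAut (maxLinkedCodes 3) (cyclicMul 4) f)
    (hmul : ∀ F ∈ maxLinkedCodes 3, ∀ G ∈ maxLinkedCodes 3,
      cyclicMul 4 F G ∈ maxLinkedCodes 3) (hA : f 52428 = 52428)
    (hV : f 64704 = 64704) : ∀ F ∈ maxLinkedCodes 3, f F = F := by
  have hV' : f 60072 = 60072 := by
    have h1 : cyclicMul 4 64704 64704 = 60072 := by decide +kernel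
    rw [← h1, hf.map_mul _ (by decide +kernel) _ (by decide +kernel), hV]
  have h3 := fun G hG hfG =>
    hf.fixes_orbitList hmul (G := G) (by decide +kernel) hA 4 hG hfG
  have h4 : ∀ F ∈ maxLinkedCodes 3, F ∈ orbitList (cyclicMul 4) 52428 4 52428 ∨
      F ∈ orbitList (cyclicMul 4) 52428 4 64704 ∨
      F ∈ orbitList (cyclicMul 4) 52428 4 60072 := by
    decide +kernel
  intro F hF
  rcases h4 F hF with h | h | h
  · exact h3 _ (by decide +kernel) hA F h
  · exact h3 _ (by decide +kernel) hV F h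
  · exact h3 _ (by decide +kernel) hV' F h

/-- The map which translates the four families in the orbit of the family with code `64704` by the
element of order two, whose principal ultrafilter has code `61680`, and fixes the other families. -/
noncomputable def flipOrbit (F : ℕ) : ℕ :=
  if F ∈ [64704, 64160, 61064, 59624] then cyclicMul 4 61680 F else F

/-- The group is generated by the involutions induced by inversion and by `flipOrbit`. -/
theorem aut_cyclicOp_four {U : Type u} [Semigroup U] (e : U ≃ Fin 4)
    (hop : ∀ x y, (e (x * y) : ℕ) = cyclicOp 4 (e x) (e y)) :
    Nonempty (AutSuperext U ≃* CyclicGrp 2 × CyclicGrp 2) := by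
  obtain ⟨code, h⟩ : ∃ code, IsCoding (Superextension U) (maxLinkedCodes 3) (cyclicMul 4) code :=
    exists_isCoding e hop
  have hA : 52428 ∈ maxLinkedCodes 3 := by decide +kernel
  have hV : 64704 ∈ maxLinkedCodes 3 := by decide +kernel
  obtain ⟨a, ha⟩ := h.surj 52428 hA
  obtain ⟨v, hv⟩ := h.surj 64704 hV
  have hinj : Function.Injective fun (φ : AutSuperext U) (b : Bool) => φ (bif b then a else v) :=
    mulAut_injective_of_rigid _ fun φ hφ => by
      obtain ⟨f, hf, hφf⟩ := h.exists_isCodeAut φ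
      refine h.eq_one_of_code hφf
        (fixes_of_fixes_generator_four hf (fun _ hF _ hG => h.mul_mem hF hG) ?_ ?_)
      · rw [← ha, ← hφf, show φ a = a from hφ true]
      · rw [← hv, ← hφf, show φ v = v from hφ false]
  obtain ⟨hfin, hcard⟩ := finite_and_card_le_length
    (fun φ : AutSuperext U => (code (φ a), code (φ v)))
    (fun φ ψ hφψ => hinj (funext fun b => by
      have h1 := Prod.ext_iff.1 hφψ
      cases b
      · exact h.injective h1.2
      · exact h.injective h1.1))
    [(52428, 64704), (52428, 61064), (65280, 64704), (65280, 61064)] fun φ => by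
      obtain ⟨f, hf, hφf⟩ := h.exists_isCodeAut φ
      simp only [hφf, ha, hv]
      -- Here `43690` is the unit. The conditions on `X` say that it is a unit of order four; those
      -- on `Y` say that `Y * Y` is an idempotent other than `Y` and the unit, and that `Y` is not
      -- the translate of `Y * Y` by the element of order two.
      have h1 : ∀ X ∈ maxLinkedCodes 3, ∀ Y ∈ maxLinkedCodes 3,
          cyclicMul 4 X X ≠ 43690 →
          cyclicMul 4 (cyclicMul 4 X X)
            (cyclicMul 4 X X) = 43690 →
          cyclicMul 4 Y Y ≠ Y →
          cyclicMul 4 Y Y ≠ 43690 →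
          cyclicMul 4 (cyclicMul 4 Y Y)
            (cyclicMul 4 Y Y) = cyclicMul 4 Y Y →
          cyclicMul 4 (cyclicMul 4 X X)
            (cyclicMul 4 Y Y) ≠ Y →
          (X, Y) ∈ [(52428, 64704), (52428, 61064), (65280, 64704), (65280, 61064)] := by
        decide +kernel
      have hm : ∀ F ∈ maxLinkedCodes 3, ∀ G ∈ maxLinkedCodes 3,
        cyclicMul 4 F G ∈ maxLinkedCodes 3 := fun _ hF _ hG => h.mul_mem hF hG
      have hone : f 43690 = 43690 := hf.map_one (by decide +kernel) (by decide +kernel)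
        (by decide +kernel)
      have hO : 43690 ∈ maxLinkedCodes 3 := by decide +kernel
      have hAA := hm _ hA _ hA
      have hVV := hm _ hV _ hV
      refine h1 _ (hf.mem _ hA) _ (hf.mem _ hV) ?_ ?_ ?_ ?_ ?_ ?_
      · rw [← hf.map_mul _ hA _ hA, ← hone]
        exact fun h2 => absurd (hf.inj _ hAA _ hO h2) (by decide +kernel)
      · rw [← hf.map_mul _ hA _ hA, ← hf.map_mul _ hAA _ hAA, ← hone]
        exact congrArg f (by decide +kernel)
      · rw [← hf.map_mul _ hV _ hV]
        exact fun h2 => absurd (hf.inj _ hVV _ hV h2) (by decide +kernel)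
      · rw [← hf.map_mul _ hV _ hV, ← hone]
        exact fun h2 => absurd (hf.inj _ hVV _ hO h2) (by decide +kernel)
      · rw [← hf.map_mul _ hV _ hV, ← hf.map_mul _ hVV _ hVV]
        exact congrArg f (by decide +kernel)
      · rw [← hf.map_mul _ hA _ hA, ← hf.map_mul _ hV _ hV, ← hf.map_mul _ hAA _ hVV]
        exact fun h2 => absurd (hf.inj _ (hm _ hAA _ hVV) _ hV h2) (by decide +kernel)
  have hinv : ∀ F ∈ maxLinkedCodes 3,
      relabel 4 (fun b => 3 * b % 4) (relabel 4 (fun b => 3 * b % 4) F) = F := by decide +kernel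
  have hflip : ∀ F ∈ maxLinkedCodes 3, flipOrbit (flipOrbit F) = F := by decide +kernel
  obtain ⟨ψ, hψ⟩ := h.exists_mulAut _ _ (by decide +kernel) hinv
    fun F _ G _ => relabel_mulCode (by decide) (by decide) F G
  obtain ⟨χ, hχ⟩ := h.exists_mulAut _ _ (by decide +kernel) hflip (by decide +kernel)
  have hψa : code (ψ a) ≠ code a := by rw [hψ, ha]; decide +kernel
  have hχa : code (χ a) = code a := by rw [hχ, ha]; decide +kernel
  have hχv : code (χ v) ≠ code v := by rw [hχ, hv]; decide +kernel
  refine nonempty_mulEquiv_klein (x := ψ) (y := χ) (by simpa using hcard) ?_ ?_ ?_ ?_ ?_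
  · exact MulEquiv.ext fun x => h.injective (by
      rw [MulAut.mul_apply, hψ, hψ, hinv _ (h.mem x)]; rfl)
  · exact MulEquiv.ext fun x => h.injective (by
      rw [MulAut.mul_apply, hχ, hχ, hflip _ (h.mem x)]; rfl)
  · rintro rfl
    exact hψa rfl
  · rintro rfl
    exact hχv rfl
  · rintro rfl
    exact hψa hχa

end Four

/-! ### The cyclic group of order five -/

namespace CyclicFive

/-- The product of codes of maximal linked upfamilies on the cyclic group of order five. -/
noncomputable abbrev mul : ℕ → ℕ → ℕ := cyclicMul 5

/-- The codes of the principal ultrafilters. -/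
def unitCodes : List ℕ := [2863311530, 3435973836, 4042322160, 4278255360, 4294901760]

/-- The code of the principal ultrafilter at a generator. -/
abbrev gen : ℕ := 3435973836

/-- The code of the idempotent that is a right identity on the families other than principal
ultrafilters. -/
abbrev rho : ℕ := 3937053352

/-- The code of an idempotent; together with `phi` and `rho` it serves to recover a family from
products. -/
abbrev eps : ℕ := 4008355976

/-- The code of another idempotent, which enters in the same way as `eps`. -/
abbrev phi : ℕ := 4205374112

/-- The code of a family whose product with `rho` is `eps`. -/
abbrev epsRoot : ℕ := 4004162184

/-- The code of a family whose product with `rho` is `phi`. -/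
abbrev phiRoot : ℕ := 4205488800

/-- For `x = gen` and `r = rho`, this condition forces `E = eps`, `F = phi` and `U = epsRoot`: the
families `U`, `V`, `W` have the same product `E` with `r`, while their products with `F` are
distinct translates of each other, by the powers of `x` with exponents `1` and `2`. -/
def IsEpsConfig (x r E F U V W : ℕ) : Prop :=
  mul E E = E ∧ mul x E ≠ E ∧ mul F F = F ∧ mul r U = E ∧ mul x (mul U F) ≠ mul U F ∧
    mul r V = E ∧ mul V F = mul x (mul U F) ∧
    mul r W = E ∧ mul W F = mul x (mul x (mul U F))

/-- For `x = gen`, `r = rho`, `E = eps` and `F = phi`, this condition forces `U = phiRoot`. It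
differs from `IsEpsConfig` in the exchanged roles of `eps` and `phi` and in the exponents of `x`,
which are now `1` and `3`. -/
def IsPhiConfig (x r E F U V W : ℕ) : Prop :=
  mul r U = F ∧ mul x (mul U E) ≠ mul U E ∧
    mul r V = F ∧ mul V E = mul x (mul U E) ∧
    mul r W = F ∧ mul W E = mul x (mul x (mul x (mul U E)))

theorem isEpsConfig : IsEpsConfig gen rho eps phi epsRoot 4008609928 3941247144 := by
  unfold IsEpsConfig
  decide +kernel

theorem isPhiConfig : IsPhiConfig gen rho eps phi phiRoot 3936938664 4204853920 := by
  unfold IsPhiConfig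
  decide +kernel

theorem IsEpsConfig.unique {E F U V W : ℕ} (hE : E ∈ maxLinkedCodes 4) (hF : F ∈ maxLinkedCodes 4)
    (hU : U ∈ maxLinkedCodes 4) (hV : V ∈ maxLinkedCodes 4) (hW : W ∈ maxLinkedCodes 4)
    (h : IsEpsConfig gen rho E F U V W) : E = eps ∧ F = phi ∧ U = epsRoot := by
  have key : ∀ E ∈ maxLinkedCodes 4, mul E E = E → mul gen E ≠ E →
      ∀ F ∈ maxLinkedCodes 4, mul F F = F →
      ∀ U ∈ maxLinkedCodes 4, mul rho U = E → mul gen (mul U F) ≠ mul U F →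
      ∀ V ∈ maxLinkedCodes 4, mul rho V = E → mul V F = mul gen (mul U F) →
      ∀ W ∈ maxLinkedCodes 4, mul rho W = E → mul W F = mul gen (mul gen (mul U F)) →
      E = eps ∧ F = phi ∧ U = epsRoot := by
    decide +kernel
  obtain ⟨h1, h2, h3, h4, h5, h6, h7, h8, h9⟩ := h
  exact key E hE h1 h2 F hF h3 U hU h4 h5 V hV h6 h7 W hW h8 h9

theorem IsPhiConfig.unique {U V W : ℕ} (hU : U ∈ maxLinkedCodes 4) (hV : V ∈ maxLinkedCodes 4)
    (hW : W ∈ maxLinkedCodes 4) (h : IsPhiConfig gen rho eps phi U V W) : U = phiRoot := by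
  have key : ∀ U ∈ maxLinkedCodes 4, mul rho U = phi → mul gen (mul U eps) ≠ mul U eps →
      ∀ V ∈ maxLinkedCodes 4, mul rho V = phi → mul V eps = mul gen (mul U eps) →
      ∀ W ∈ maxLinkedCodes 4, mul rho W = phi →
        mul W eps = mul gen (mul gen (mul gen (mul U eps))) → U = phiRoot := by
    decide +kernel
  obtain ⟨h1, h2, h3, h4, h5, h6⟩ := h
  exact key U hU h1 h2 V hV h3 h4 W hW h5 h6

/-- Products with `rho`, `eps` and `phi` determine a family that is not a principal ultrafilter. -/
theorem eq_of_mul_eq : ∀ X ∈ maxLinkedCodes 4, ∀ Y ∈ maxLinkedCodes 4, mul rho X = mul rho Y →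
    mul X eps = mul Y eps → mul X phi = mul Y phi → X = Y ∨ X ∈ unitCodes ∨ Y ∈ unitCodes := by
  decide +kernel

/-- Products with `rho`, `eps` and `phi` are translates of a few families. -/
theorem mul_mem_orbitList : ∀ Y ∈ maxLinkedCodes 4, ∀ G ∈ [mul rho Y, mul Y eps, mul Y phi],
    ∃ H ∈ [gen, rho, eps, phi, mul epsRoot phi, mul phiRoot eps, mul eps phi],
      G ∈ orbitList mul gen 5 H := by
  decide +kernel

/-- An automorphism fixing `gen` fixes the principal ultrafilters, hence `rho`, hence `eps`, `phi`
and the products that determine the other families. -/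
theorem fixes_of_fixes_gen {f : ℕ → ℕ} (hf : IsCodeAut (maxLinkedCodes 4) mul f)
    (hm : ∀ F ∈ maxLinkedCodes 4, ∀ G ∈ maxLinkedCodes 4, mul F G ∈ maxLinkedCodes 4)
    (hx : f gen = gen) : ∀ F ∈ maxLinkedCodes 4, f F = F := by
  have mx : gen ∈ maxLinkedCodes 4 := by decide +kernel
  have mr : rho ∈ maxLinkedCodes 4 := by decide +kernel
  have me : eps ∈ maxLinkedCodes 4 := by decide +kernel
  have mp : phi ∈ maxLinkedCodes 4 := by decide +kernel
  have mu : epsRoot ∈ maxLinkedCodes 4 := by decide +kernel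
  have mu' : phiRoot ∈ maxLinkedCodes 4 := by decide +kernel
  have horb := fun H hH hfH => hf.fixes_orbitList hm mx hx 5 (G := H) hH hfH
  have hunit : ∀ F ∈ unitCodes, f F = F := by
    have h1 : ∀ F ∈ unitCodes, F ∈ orbitList mul gen 5 gen := by decide +kernel
    exact fun F hF => horb _ mx hx F (h1 F hF)
  have hunit' : ∀ F ∈ maxLinkedCodes 4, f F ∈ unitCodes → F ∈ unitCodes := by
    have h1 : ∀ F ∈ unitCodes, F ∈ maxLinkedCodes 4 := by decide +kernel
    intro F hF hfF
    rwa [← hf.inj _ (h1 _ hfF) _ hF (hunit _ hfF)]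
  have hr : f rho = rho := by
    have h1 : ∀ X ∈ maxLinkedCodes 4, X ∉ unitCodes →
        (∀ Y ∈ maxLinkedCodes 4, mul Y X = Y ∨ Y ∈ unitCodes) → X = rho := by decide +kernel
    have h2 : rho ∉ unitCodes ∧ ∀ Y ∈ maxLinkedCodes 4, mul Y rho = Y ∨ Y ∈ unitCodes := by
      decide +kernel
    refine h1 _ (hf.mem _ mr) (fun h => h2.1 (hunit' _ mr h)) fun Y hY => ?_
    obtain ⟨F, hF, rfl⟩ := hf.surj Y hY
    rw [← hf.map_mul F hF _ mr]
    refine (h2.2 F hF).imp (congrArg f) fun h => ?_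
    rwa [hunit F h]
  have hmap : ∀ F G, F ∈ maxLinkedCodes 4 → G ∈ maxLinkedCodes 4 → mul (f F) (f G) = f (mul F G) :=
    fun F G hF hG => (hf.map_mul F hF G hG).symm
  have hinj : ∀ F G, F ∈ maxLinkedCodes 4 → G ∈ maxLinkedCodes 4 → (f F = f G ↔ F = G) :=
    fun F G hF hG => ⟨hf.inj F hF G hG, congrArg f⟩
  have hm' : ∀ F G, F ∈ maxLinkedCodes 4 → G ∈ maxLinkedCodes 4 → mul F G ∈ maxLinkedCodes 4 :=
    fun F G hF hG => hm F hF G hG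
  -- Automorphisms preserve the two conditions, as these only involve products.
  have hmapE : ∀ V ∈ maxLinkedCodes 4, ∀ W ∈ maxLinkedCodes 4,
      IsEpsConfig gen rho eps phi epsRoot V W →
        IsEpsConfig (f gen) (f rho) (f eps) (f phi) (f epsRoot) (f V) (f W) := by
    intro V mV W mW h
    have m1 := hm _ mu _ mp
    have m2 := hm _ mx _ m1
    have m3 := hm _ mx _ m2
    simpa only [IsEpsConfig, ne_eq, hmap, hinj, hm', mx, mr, me, mp, mu, mV, mW, m1, m2, m3] using h
  have hmapF : ∀ V ∈ maxLinkedCodes 4, ∀ W ∈ maxLinkedCodes 4,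
      IsPhiConfig gen rho eps phi phiRoot V W →
        IsPhiConfig (f gen) (f rho) (f eps) (f phi) (f phiRoot) (f V) (f W) := by
    intro V mV W mW h
    have m1 := hm _ mu' _ me
    have m2 := hm _ mx _ m1
    have m3 := hm _ mx _ m2
    have m4 := hm _ mx _ m3
    simpa only [IsPhiConfig, ne_eq, hmap, hinj, hm', mx, mr, me, mp, mu', mV, mW, m1, m2, m3, m4]
      using h
  have h1 := hmapE _ (by decide +kernel) _ (by decide +kernel) isEpsConfig
  rw [hx, hr] at h1
  obtain ⟨he, hp, hu⟩ := h1.unique (hf.mem _ me) (hf.mem _ mp) (hf.mem _ mu)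
    (hf.mem _ (by decide +kernel)) (hf.mem _ (by decide +kernel))
  have h2 := hmapF _ (by decide +kernel) _ (by decide +kernel) isPhiConfig
  rw [hx, hr, he, hp] at h2
  have hu' := h2.unique (hf.mem _ mu') (hf.mem _ (by decide +kernel)) (hf.mem _ (by decide +kernel))
  have hfix : ∀ H ∈ [gen, rho, eps, phi, mul epsRoot phi, mul phiRoot eps, mul eps phi],
      H ∈ maxLinkedCodes 4 ∧ f H = H := by
    simp only [List.forall_mem_cons, hf.map_mul _ mu _ mp, hf.map_mul _ mu' _ me,
      hf.map_mul _ me _ mp, hx, hr, he, hp, hu, hu', and_true]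
    exact ⟨mx, mr, me, mp, hm _ mu _ mp, hm _ mu' _ me, hm _ me _ mp,
      fun _ h => absurd h List.not_mem_nil⟩
  intro Y hY
  have hprod : ∀ G ∈ [mul rho Y, mul Y eps, mul Y phi], f G = G := by
    intro G hG
    obtain ⟨H, hH, hGH⟩ := mul_mem_orbitList Y hY G hG
    exact horb H (hfix H hH).1 (hfix H hH).2 G hGH
  simp only [List.forall_mem_cons, hf.map_mul _ mr _ hY, hf.map_mul _ hY _ me,
    hf.map_mul _ hY _ mp, hr, he, hp] at hprod
  rcases eq_of_mul_eq _ (hf.mem Y hY) Y hY hprod.1 hprod.2.1 hprod.2.2.1 with h | h | h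
  · exact h
  · exact hunit Y (hunit' Y hY h)
  · exact hunit Y h

end CyclicFive

open CyclicFive in
theorem aut_cyclicOp_five {U : Type u} [Semigroup U] (e : U ≃ Fin 5)
    (hop : ∀ x y, (e (x * y) : ℕ) = cyclicOp 5 (e x) (e y)) :
    Nonempty (AutSuperext U ≃* CyclicGrp 4) := by
  obtain ⟨code, h⟩ : ∃ code, IsCoding (Superextension U) (maxLinkedCodes 4) mul code :=
    exists_isCoding e hop
  have mx : gen ∈ maxLinkedCodes 4 := by decide +kernel
  have hm : ∀ F ∈ maxLinkedCodes 4, ∀ G ∈ maxLinkedCodes 4, mul F G ∈ maxLinkedCodes 4 :=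
    fun _ hF _ hG => h.mul_mem hF hG
  obtain ⟨a, ha⟩ := h.surj gen mx
  have hrigid : ∀ φ : AutSuperext U, φ a = a → φ = 1 := by
    intro φ hφ
    obtain ⟨f, hf, hφf⟩ := h.exists_isCodeAut φ
    exact h.eq_one_of_code hφf (fixes_of_fixes_gen hf hm (by rw [← ha, ← hφf, hφ]))
  have hinj : Function.Injective fun (φ : AutSuperext U) (_ : Unit) => φ a :=
    mulAut_injective_of_rigid _ fun φ hφ => hrigid φ (hφ ())
  obtain ⟨hfin, hcard⟩ := finite_and_card_le_length (fun φ : AutSuperext U => code (φ a))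
    (fun φ ψ hφψ => hinj (funext fun _ => h.injective hφψ))
    [3435973836, 4042322160, 4278255360, 4294901760] fun φ => by
      obtain ⟨f, hf, hφf⟩ := h.exists_isCodeAut φ
      -- The elements of order five are the principal ultrafilters other than the unit.
      have h1 : ∀ X ∈ maxLinkedCodes 4, X ≠ 2863311530 →
          mul X (mul X (mul X (mul X X))) = 2863311530 →
          X ∈ [3435973836, 4042322160, 4278255360, 4294901760] := by decide +kernel
      have mo : 2863311530 ∈ maxLinkedCodes 4 := by decide +kernel
      have hone : f 2863311530 = 2863311530 :=
        hf.map_one mo (by decide +kernel) (by decide +kernel)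
      change code (φ a) ∈ _
      rw [hφf, ha]
      refine h1 _ (hf.mem _ mx) ?_ ?_
      · rw [← hone]
        exact fun h2 => absurd (hf.inj _ mx _ mo h2) (by decide +kernel)
      · have h2 := hm _ mx _ mx
        have h3 := hm _ mx _ h2
        rw [← hf.map_mul _ mx _ mx, ← hf.map_mul _ mx _ h2, ← hf.map_mul _ mx _ h3,
          ← hf.map_mul _ mx _ (hm _ mx _ h3), ← hone]
        exact congrArg f (by decide +kernel)
  -- The automorphism induced by doubling in the cyclic group has order four.
  obtain ⟨ψ, hψ⟩ := h.exists_mulAut (relabel 5 fun b => 2 * b % 5) (relabel 5 fun b => 3 * b % 5)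
    (by decide +kernel) (by decide +kernel)
    fun F _ G _ => relabel_mulCode (by decide) (by decide) F G
  have hψ2 : ψ ^ 2 ≠ 1 := by
    intro h1
    have h2 : code ((ψ ^ 2) a) = code a := by rw [h1]; rfl
    rw [pow_two, MulAut.mul_apply, hψ, hψ, ha] at h2
    exact absurd h2 (by decide +kernel)
  have hψ4 : ψ ^ 4 = 1 := by
    refine hrigid _ (h.injective ?_)
    change code (ψ (ψ (ψ (ψ a)))) = code a
    rw [hψ, hψ, hψ, hψ, ha]
    decide +kernel
  have hord : orderOf ψ = 4 := orderOf_eq_prime_pow (p := 2) (n := 1) hψ2 hψ4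
  have hc : Nat.card (AutSuperext U) = 4 :=
    le_antisymm hcard (Nat.le_of_dvd Nat.card_pos (hord ▸ orderOf_dvd_natCard ψ))
  have := isCyclic_of_orderOf_eq_card ψ (hord.trans hc.symm)
  exact ⟨mulEquivOfCyclicCardEq (by rw [hc]; simp)⟩

/-! ### Automorphism groups of superextensions of monogenic semigroups -/

namespace IsMonogenicOfIndexPeriod

variable {S : Type u} [Semigroup S] {r m : ℕ}

theorem aut_self (h : IsMonogenicOfIndexPeriod S r m) (hr : 1 < r) {G : Type*} [Mul G]
    (H : ∀ {U : Type u} [Semigroup U] (e : U ≃ Fin (r + m - 1)),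
      (∀ x y, (e (x * y) : ℕ) = powerOp r m 1 (e x) (e y)) → Nonempty (AutSuperext U ≃* G)) :
    Nonempty (AutSuperext S ≃* G) :=
  (h.exists_equiv_powerOp le_rfl hr (U := S) id Function.injective_id (fun _ _ => rfl)
    Set.range_id).elim H

theorem aut_self_of_index_one (h : IsMonogenicOfIndexPeriod S r m) (hr : r = 1) {G : Type*} [Mul G]
    (H : ∀ {U : Type u} [Semigroup U] (e : U ≃ Fin m),
      (∀ x y, (e (x * y) : ℕ) = cyclicOp m (e x) (e y)) → Nonempty (AutSuperext U ≃* G)) :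
    Nonempty (AutSuperext S ≃* G) :=
  (h.exists_equiv_cyclicOp (k := 1) hr.le (U := S) id Function.injective_id (fun _ _ => rfl)
    Set.range_id).elim H

theorem aut_idealPow (h : IsMonogenicOfIndexPeriod S r m) {k : ℕ} (hk : 1 ≤ k) (hkr : k < r)
    {G : Type*} [Mul G]
    (H : ∀ {U : Type u} [Semigroup U] (e : U ≃ Fin (r + m - k)),
      (∀ x y, (e (x * y) : ℕ) = powerOp r m k (e x) (e y)) → Nonempty (AutSuperext U ≃* G)) :
    Nonempty (AutSuperext (idealPow S k) ≃* G) :=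
  (h.exists_equiv_powerOp hk hkr (U := idealPow S k) Subtype.val Subtype.val_injective
    (fun _ _ => rfl) Subtype.range_val).elim H

/-- From the exponent `r` on, the powers of a monogenic semigroup are its maximal subgroup. -/
theorem aut_idealPow_of_le (h : IsMonogenicOfIndexPeriod S r m) {G : Type*} [Mul G]
    (H : ∀ {U : Type u} [Semigroup U] (e : U ≃ Fin m),
      (∀ x y, (e (x * y) : ℕ) = cyclicOp m (e x) (e y)) → Nonempty (AutSuperext U ≃* G))
    (k : ℕ) (hk : r ≤ k) : Nonempty (AutSuperext (idealPow S k) ≃* G) :=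
  (h.exists_equiv_cyclicOp hk (U := idealPow S k) Subtype.val Subtype.val_injective
    (fun _ _ => rfl) Subtype.range_val).elim H

end IsMonogenicOfIndexPeriod

theorem mainTheorem1 (S : Type u) [Semigroup S] :
    (IsMonogenicOfIndexPeriod S 1 1 →
      Nonempty (AutSuperext S ≃* CyclicGrp 1) ∧
      (∀ k : ℕ, 1 ≤ k → Nonempty (AutSuperext (idealPow S k) ≃* CyclicGrp 1))) ∧
    (IsMonogenicOfIndexPeriod S 1 2 →
      Nonempty (AutSuperext S ≃* CyclicGrp 1) ∧
      (∀ k : ℕ, 1 ≤ k → Nonempty (AutSuperext (idealPow S k) ≃* CyclicGrp 1))) ∧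
    (IsMonogenicOfIndexPeriod S 2 1 →
      Nonempty (AutSuperext S ≃* CyclicGrp 1) ∧
      (∀ k : ℕ, 2 ≤ k → Nonempty (AutSuperext (idealPow S k) ≃* CyclicGrp 1))) ∧
    (IsMonogenicOfIndexPeriod S 1 3 →
      Nonempty (AutSuperext S ≃* CyclicGrp 2) ∧
      (∀ k : ℕ, 1 ≤ k → Nonempty (AutSuperext (idealPow S k) ≃* CyclicGrp 2))) ∧
    (IsMonogenicOfIndexPeriod S 2 2 →
      Nonempty (AutSuperext S ≃* CyclicGrp 2) ∧
      (∀ k : ℕ, 2 ≤ k → Nonempty (AutSuperext (idealPow S k) ≃* CyclicGrp 1))) ∧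
    (IsMonogenicOfIndexPeriod S 3 1 →
      Nonempty (AutSuperext S ≃* CyclicGrp 1) ∧
      Nonempty (AutSuperext (idealPow S 2) ≃* CyclicGrp 1) ∧
      (∀ k : ℕ, 3 ≤ k → Nonempty (AutSuperext (idealPow S k) ≃* CyclicGrp 1))) ∧
    (IsMonogenicOfIndexPeriod S 1 4 →
      Nonempty (AutSuperext S ≃* (CyclicGrp 2 × CyclicGrp 2)) ∧
      (∀ k : ℕ, 1 ≤ k → Nonempty (AutSuperext (idealPow S k) ≃* (CyclicGrp 2 × CyclicGrp 2)))) ∧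
    (IsMonogenicOfIndexPeriod S 2 3 →
      Nonempty (AutSuperext S ≃* (SymGrp 3 × SymGrp 5)) ∧
      (∀ k : ℕ, 2 ≤ k → Nonempty (AutSuperext (idealPow S k) ≃* CyclicGrp 2))) ∧
    (IsMonogenicOfIndexPeriod S 3 2 →
      Nonempty (AutSuperext S ≃* (SymGrp 3 × SymGrp 4)) ∧
      Nonempty (AutSuperext (idealPow S 2) ≃* CyclicGrp 2) ∧
      (∀ k : ℕ, 3 ≤ k → Nonempty (AutSuperext (idealPow S k) ≃* CyclicGrp 1))) ∧
    (IsMonogenicOfIndexPeriod S 4 1 →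
      Nonempty (AutSuperext S ≃* (SymGrp 3 × SymGrp 4)) ∧
      Nonempty (AutSuperext (idealPow S 2) ≃* SymGrp 3) ∧
      Nonempty (AutSuperext (idealPow S 3) ≃* CyclicGrp 1) ∧
      (∀ k : ℕ, 4 ≤ k → Nonempty (AutSuperext (idealPow S k) ≃* CyclicGrp 1))) ∧
    (IsMonogenicOfIndexPeriod S 1 5 →
      Nonempty (AutSuperext S ≃* CyclicGrp 4) ∧
      (∀ k : ℕ, 1 ≤ k → Nonempty (AutSuperext (idealPow S k) ≃* CyclicGrp 4))) ∧
    (IsMonogenicOfIndexPeriod S 2 4 →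
      Nonempty (AutSuperext S ≃* ((Fin 3 → SymGrp 3) × (Fin 3 → SymGrp 8) × SymGrp 17 × SymGrp 19)) ∧
      (∀ k : ℕ, 2 ≤ k → Nonempty (AutSuperext (idealPow S k) ≃* (CyclicGrp 2 × CyclicGrp 2)))) ∧
    (IsMonogenicOfIndexPeriod S 3 3 →
      Nonempty (AutSuperext S ≃* ((Fin 3 → SymGrp 4) × SymGrp 5 × (Fin 2 → SymGrp 9) × SymGrp 14 × SymGrp 18)) ∧
      Nonempty (AutSuperext (idealPow S 2) ≃* (SymGrp 3 × SymGrp 5)) ∧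
      (∀ k : ℕ, 3 ≤ k → Nonempty (AutSuperext (idealPow S k) ≃* CyclicGrp 2))) ∧
    (IsMonogenicOfIndexPeriod S 4 2 →
      Nonempty (AutSuperext S ≃* ((Fin 3 → SymGrp 4) × SymGrp 5 × (Fin 2 → SymGrp 9) × SymGrp 14 × SymGrp 18)) ∧
      Nonempty (AutSuperext (idealPow S 2) ≃* (SymGrp 5 × SymGrp 5)) ∧
      Nonempty (AutSuperext (idealPow S 3) ≃* CyclicGrp 2) ∧
      (∀ k : ℕ, 4 ≤ k → Nonempty (AutSuperext (idealPow S k) ≃* CyclicGrp 1))) ∧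
    (IsMonogenicOfIndexPeriod S 5 1 →
      Nonempty (AutSuperext S ≃* ((Fin 3 → SymGrp 4) × SymGrp 5 × (Fin 2 → SymGrp 9) × SymGrp 14 × SymGrp 18)) ∧
      Nonempty (AutSuperext (idealPow S 2) ≃* SymGrp 9) ∧
      Nonempty (AutSuperext (idealPow S 3) ≃* SymGrp 3) ∧
      Nonempty (AutSuperext (idealPow S 4) ≃* CyclicGrp 1) ∧
      (∀ k : ℕ, 5 ≤ k → Nonempty (AutSuperext (idealPow S k) ≃* CyclicGrp 1))) :=
  ⟨fun h => ⟨h.aut_self_of_index_one rfl aut_cyclicOp_one,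
      h.aut_idealPow_of_le aut_cyclicOp_one⟩,
    fun h => ⟨h.aut_self_of_index_one rfl aut_cyclicOp_two,
      h.aut_idealPow_of_le aut_cyclicOp_two⟩,
    fun h => ⟨h.aut_self (by decide) aut_powerOp_2_1_1,
      h.aut_idealPow_of_le aut_cyclicOp_one⟩,
    fun h => ⟨h.aut_self_of_index_one rfl aut_cyclicOp_three,
      h.aut_idealPow_of_le aut_cyclicOp_three⟩,
    fun h => ⟨h.aut_self (by decide) aut_powerOp_2_2_1,
      h.aut_idealPow_of_le aut_cyclicOp_two⟩,
    fun h => ⟨h.aut_self (by decide) aut_powerOp_3_1_1,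
      h.aut_idealPow (by decide) (by decide) aut_powerOp_3_1_2,
      h.aut_idealPow_of_le aut_cyclicOp_one⟩,
    fun h => ⟨h.aut_self_of_index_one rfl aut_cyclicOp_four,
      h.aut_idealPow_of_le aut_cyclicOp_four⟩,
    fun h => ⟨h.aut_self (by decide) aut_powerOp_2_3_1,
      h.aut_idealPow_of_le aut_cyclicOp_three⟩,
    fun h => ⟨h.aut_self (by decide) aut_powerOp_3_2_1,
      h.aut_idealPow (by decide) (by decide) aut_powerOp_3_2_2,
      h.aut_idealPow_of_le aut_cyclicOp_two⟩,
    fun h => ⟨h.aut_self (by decide) aut_powerOp_4_1_1,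
      h.aut_idealPow (by decide) (by decide) aut_powerOp_4_1_2,
      h.aut_idealPow (by decide) (by decide) aut_powerOp_4_1_3,
      h.aut_idealPow_of_le aut_cyclicOp_one⟩,
    fun h => ⟨h.aut_self_of_index_one rfl aut_cyclicOp_five,
      h.aut_idealPow_of_le aut_cyclicOp_five⟩,
    fun h => ⟨h.aut_self (by decide) aut_powerOp_2_4_1,
      h.aut_idealPow_of_le aut_cyclicOp_four⟩,
    fun h => ⟨h.aut_self (by decide) aut_powerOp_3_3_1,
      h.aut_idealPow (by decide) (by decide) aut_powerOp_3_3_2,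
      h.aut_idealPow_of_le aut_cyclicOp_three⟩,
    fun h => ⟨h.aut_self (by decide) aut_powerOp_4_2_1,
      h.aut_idealPow (by decide) (by decide) aut_powerOp_4_2_2,
      h.aut_idealPow (by decide) (by decide) aut_powerOp_4_2_3,
      h.aut_idealPow_of_le aut_cyclicOp_two⟩,
    fun h => ⟨h.aut_self (by decide) aut_powerOp_5_1_1,
      h.aut_idealPow (by decide) (by decide) aut_powerOp_5_1_2,
      h.aut_idealPow (by decide) (by decide) aut_powerOp_5_1_3,
      h.aut_idealPow (by decide) (by decide) aut_powerOp_5_1_4,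
      h.aut_idealPow_of_le aut_cyclicOp_one⟩⟩
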